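/- Let $n\ge 1$, $p>1$, $x_0\in\mathbb{R}^n$ and $t_0<0$. For $t<0$ put $G(y,t)=(-4\pi t)^{-n/2}e^{|y|^2/(4t)}$ and $$F_{x_0,t_0}(w)=\tfrac12(-t_0)^{\frac{p+1}{p-1}}\int_{\mathbb{R}^n}|\nabla w|^2G(y-x_0,t_0)\,dy-\tfrac1{p+1}(-t_0)^{\frac{p+1}{p-1}}\int_{\mathbb{R}^n}|w|^{p+1}G(y-x_0,t_0)\,dy+\tfrac1{2(p-1)}(-t_0)^{\frac{2}{p-1}}\int_{\mathbb{R}^n}w^2G(y-x_0,t_0)\,dy .$$ Call a bounded function $w\in C^\infty(\mathbb{R}^n)$ a critical point of $F_{x_0,t_0}$ if for every $\phi\in C_c^\infty(\mathbb{R}^n)$ and all curves $s\mapsto x(s)\in\mathbb{R}^n$, $s\mapsto t(s)\in\mathbb{R}$ with $x(0)=x_0$, $t(0)=t_0$ that are differentiable at $s=0$, the three integrals in $F_{x(s),t(s)}(w+s\phi)$ converge for all $s$ near $0$, and $$\frac{d}{ds}\Big|_{s=0}F_{x(s),t(s)}(w+s\phi)\quad\text{exists and equals }0 .$$ Let $w:\mathbb{R}^n\to\mathbb{R}$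 be a bounded smooth function. Then $w$ is a critical point of $F_{x_0,t_0}$ if and only if $$\Delta w+\frac{y-x_0}{2t_0}\cdot\nabla w+\frac{1}{(p-1)t_0}w+|w|^{p-1}w=0\quad\text{in }\mathbb{R}^n. \qquad (*)$$ Moreover, $(*)$ holds if and only if $w$ is the time $t=t_0$ slice of a self-similar solution, that is, there is a smooth solution $u$ of $\partial_tu=\Delta u+|u|^{p-1}u$ on $\mathbb{R}^n\times(-\infty,0)$ with $u(x_0+rx,r^2t)=r^{-2/(p-1)}u(x_0+x,t)$ for all $r>0$, $x\in\mathbb{R}^n$, $t<0$, such that $u(\cdot,t_0)=w$. -/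

import Mathlib

open MeasureTheory Filter Topology
open scoped ContDiff Gradient Laplacian

noncomputable section

namespace FujitaF

/-- The Gaussian `G(y, t) = (-4πt)^{-n/2} e^{|y|²/(4t)}`, used for `t < 0`. -/
def G {n : ℕ} (y : EuclideanSpace ℝ (Fin n)) (t : ℝ) : ℝ :=
  (-(4 * Real.pi * t)) ^ (-(n : ℝ) / 2) * Real.exp (‖y‖ ^ 2 / (4 * t))

/-- The three integrals in the functional `F_{x₀,t₀}(w)` converge. -/
structure FiniteF {n : ℕ} (p : ℝ) (x₀ : EuclideanSpace ℝ (Fin n)) (t₀ : ℝ)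
    (w : EuclideanSpace ℝ (Fin n) → ℝ) : Prop where
  gradient_term : Integrable (fun y => ‖∇ w y‖ ^ 2 * G (y - x₀) t₀)
  power_term : Integrable (fun y => |w y| ^ (p + 1) * G (y - x₀) t₀)
  square_term : Integrable (fun y => w y ^ 2 * G (y - x₀) t₀)

/-- The functional `F_{x₀,t₀}(w)`; meaningful when `t₀ < 0` and `FiniteF p x₀ t₀ w` holds. -/
def F {n : ℕ} (p : ℝ) (x₀ : EuclideanSpace ℝ (Fin n)) (t₀ : ℝ)
    (w : EuclideanSpace ℝ (Fin n) → ℝ) : ℝ :=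
  1 / 2 * (-t₀) ^ ((p + 1) / (p - 1)) * (∫ y, ‖∇ w y‖ ^ 2 * G (y - x₀) t₀)
    - 1 / (p + 1) * (-t₀) ^ ((p + 1) / (p - 1)) * (∫ y, |w y| ^ (p + 1) * G (y - x₀) t₀)
    + 1 / (2 * (p - 1)) * (-t₀) ^ (2 / (p - 1)) * (∫ y, w y ^ 2 * G (y - x₀) t₀)

/-- `w` is a critical point of `F_{x₀,t₀}` under simultaneous variations of all three arguments:
for every test function `φ ∈ C_c^∞(ℝⁿ)` and all curves `x(s)`, `t(s)` with `x(0) = x₀`,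
`t(0) = t₀` having derivatives at `s = 0`, the number `F_{x(s),t(s)}(w + sφ)` is well defined (all
integrals converge) for `s` near `0`, and its derivative at `s = 0` exists and vanishes.
(For `t₀ < 0`, one has `t(s) < 0` for `s` near `0`; only such `s` matter.) -/
def IsCriticalPoint {n : ℕ} (p : ℝ) (x₀ : EuclideanSpace ℝ (Fin n)) (t₀ : ℝ)
    (w : EuclideanSpace ℝ (Fin n) → ℝ) : Prop :=
  ∀ (φ : EuclideanSpace ℝ (Fin n) → ℝ) (x : ℝ → EuclideanSpace ℝ (Fin n)) (t : ℝ → ℝ),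
    ContDiff ℝ ∞ φ → HasCompactSupport φ →
    x 0 = x₀ → t 0 = t₀ → DifferentiableAt ℝ x 0 → DifferentiableAt ℝ t 0 →
      (∀ᶠ s in 𝓝 (0 : ℝ), FiniteF p (x s) (t s) (fun y => w y + s * φ y)) ∧
      HasDerivAt (fun s : ℝ => F p (x s) (t s) (fun y => w y + s * φ y)) 0 0

/-- `u` is a smooth solution of `∂ₜu = Δu + |u|^{p-1}u` on `ℝⁿ × (-∞, 0)` which is backward
self-similar with respect to the space-time point `(x₀, 0)`. -/
structure IsSelfSimilarSolution {n : ℕ} (p : ℝ) (x₀ : EuclideanSpace ℝ (Fin n))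
    (u : EuclideanSpace ℝ (Fin n) → ℝ → ℝ) : Prop where
  smooth : ContDiffOn ℝ ∞ (fun z : EuclideanSpace ℝ (Fin n) × ℝ => u z.1 z.2) {z | z.2 < 0}
  equation : ∀ (x : EuclideanSpace ℝ (Fin n)) (t : ℝ), t < 0 →
    deriv (fun τ => u x τ) t = Δ (fun z => u z t) x + |u x t| ^ (p - 1) * u x t
  self_similar : ∀ (r : ℝ) (x : EuclideanSpace ℝ (Fin n)) (t : ℝ), 0 < r → t < 0 →
    u (x₀ + r • x) (r ^ 2 * t) = r ^ (-(2 / (p - 1))) * u (x₀ + x) t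

/-- `w` solves `Δw + ((y - x₀)/(2t₀))·∇w + w/((p-1)t₀) + |w|^{p-1}w = 0` in `ℝⁿ`. -/
def SolvesProfileEquation {n : ℕ} (p : ℝ) (x₀ : EuclideanSpace ℝ (Fin n)) (t₀ : ℝ)
    (w : EuclideanSpace ℝ (Fin n) → ℝ) : Prop :=
  ∀ y : EuclideanSpace ℝ (Fin n),
    Δ w y + inner ℝ ((1 / (2 * t₀)) • (y - x₀)) (∇ w y)
      + 1 / ((p - 1) * t₀) * w y + |w y| ^ (p - 1) * w y = 0

end FujitaF

end

open MeasureTheory Filter Topology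
open scoped ContDiff Gradient Laplacian

set_option linter.unusedSectionVars false

noncomputable section

/-! Put κ = -1/(4t₀) > 0. Up to a constant factor G(y - x₀, t₀) is the weight e^{-κ|y - x₀|²}, and
the drift Laplacian Δ - 2κ(y - x₀)·∇ is symmetric for this weight. Hence (*) is the Euler-Lagrange
equation of F with x₀ and t₀ frozen, and a critical point solves it by the fundamental lemma of the
calculus of variations applied along constant curves.

Conversely, moving x₀ and t₀ imposes nothing new. Translations and dilations of the variable move
the centre and the time of the Gaussian, so the variation of F with x'(0) = v, t'(0) = τ amounts to
testing (*) against the generator αw + X·∇w, where X = b(y - x₀) + v, b = τ/(2t₀), α = 2b/(p - 1).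
`hasDerivAt_F_of_gradient` records this at the level of integrands, and `integral_pohozaev` shows
that the resulting integral vanishes.

The difficulty is that nothing is assumed about the growth of ∇w. The Caccioppoli estimate
`gaussInt_norm_gradient_sq` deduces from the equation and the boundedness of w that |∇w|² is
integrable against every Gaussian. This justifies both differentiation under the integral sign
(`hasDerivAt_integral_mul_G`) and the removal of cutoffs in the Pohozaev identity.

As for self-similarity, the scaling law determines u from its slice at t₀, and the defect of the
extension in the heat equation is a positive multiple of the defect of w in (*). -/

namespace FujitaF

/-! ### Gaussian weights and integration by parts with compact support -/

section Divergence

variable {E : Type*} [NormedAddCommGroup E] [InnerProductSpace ℝ E]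

/-- The centred Gaussian weight `e^{-κ|y - x₀|²}`. -/
def gauss (x₀ : E) (κ : ℝ) (y : E) : ℝ := Real.exp (-κ * ‖y - x₀‖ ^ 2)

theorem gauss_pos (x₀ : E) (κ : ℝ) (y : E) : 0 < gauss x₀ κ y := Real.exp_pos _

theorem contDiff_gauss (x₀ : E) (κ : ℝ) {m : WithTop ℕ∞} : ContDiff ℝ m (gauss x₀ κ) := by
  unfold gauss
  exact (contDiff_const.mul ((contDiff_id.sub contDiff_const).norm_sq ℝ)).exp

theorem continuous_gauss (x₀ : E) (κ : ℝ) : Continuous (gauss x₀ κ) :=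
  (contDiff_gauss x₀ κ (m := 0)).continuous

theorem gauss_add (x₀ : E) (κ κ' : ℝ) (y : E) :
    gauss x₀ (κ + κ') y = gauss x₀ κ y * gauss x₀ κ' y := by
  unfold gauss
  rw [← Real.exp_add]
  ring_nf

theorem hasFDerivAt_gauss (x₀ : E) (κ : ℝ) (y : E) :
    HasFDerivAt (gauss x₀ κ) ((-2 * κ * gauss x₀ κ y) • innerSL ℝ (y - x₀)) y := by
  have h1 : HasFDerivAt (fun y : E => ‖y - x₀‖ ^ 2) (2 • innerSL ℝ (y - x₀)) y := by
    simpa using ((hasFDerivAt_id y).sub_const x₀).norm_sq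
  have h2 := (h1.const_mul (-κ)).exp
  refine h2.congr_fderiv ?_
  ext v
  simp [gauss]
  ring

theorem fderiv_gauss_apply (x₀ : E) (κ : ℝ) (y v : E) :
    fderiv ℝ (gauss x₀ κ) y v = -2 * κ * inner ℝ (y - x₀) v * gauss x₀ κ y := by
  rw [(hasFDerivAt_gauss x₀ κ y).fderiv, smul_apply, innerSL_apply_apply,
    smul_eq_mul]
  ring

theorem fderiv_mul_apply {f g : E → ℝ} {y : E} (hf : DifferentiableAt ℝ f y)
    (hg : DifferentiableAt ℝ g y) (v : E) :
    fderiv ℝ (fun x => f x * g x) y v = f y * fderiv ℝ g y v + fderiv ℝ f y v * g y := by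
  rw [fderiv_fun_mul hf hg]
  simp [mul_comm]

variable [FiniteDimensional ℝ E]

theorem laplacian_eq_sum_fderiv {ι : Type*} [Fintype ι] (e : OrthonormalBasis ι ℝ E)
    (w : E → ℝ) (y : E) :
    Δ w y = ∑ i, fderiv ℝ (fderiv ℝ w) y (e i) (e i) := by
  rw [InnerProductSpace.laplacian_eq_iteratedFDeriv_orthonormalBasis w e]
  simp [iteratedFDeriv_two_apply]

theorem contDiff_fderiv {w : E → ℝ} (hw : ContDiff ℝ ∞ w) : ContDiff ℝ ∞ (fderiv ℝ w) :=
  hw.fderiv_right (by simp)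

theorem contDiff_gradient {w : E → ℝ} (hw : ContDiff ℝ ∞ w) : ContDiff ℝ ∞ (∇ w) :=
  ((InnerProductSpace.toDual ℝ E).symm.toContinuousLinearEquiv.contDiff).comp (contDiff_fderiv hw)

theorem continuous_laplacian {w : E → ℝ} (hw : ContDiff ℝ ∞ w) : Continuous (Δ w) := by
  have h : Δ w = fun y => ∑ i, fderiv ℝ (fderiv ℝ w) y (stdOrthonormalBasis ℝ E i)
      (stdOrthonormalBasis ℝ E i) := by
    ext y
    exact laplacian_eq_sum_fderiv _ w y
  have hc : Continuous (fderiv ℝ (fderiv ℝ w)) :=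
    (contDiff_fderiv hw).continuous_fderiv (by simp)
  rw [h]
  fun_prop

theorem sum_fderiv_mul_inner {ι : Type*} [Fintype ι] (e : OrthonormalBasis ι ℝ E)
    (L : E →L[ℝ] ℝ) (v : E) : ∑ i, inner ℝ (e i) v * L (e i) = L v := by
  conv_rhs => rw [← e.sum_repr' v]
  simp

variable [MeasurableSpace E] [BorelSpace E]

theorem integrable_fderiv_apply {f : E → ℝ} (hf : ContDiff ℝ 1 f) (hc : HasCompactSupport f)
    (v : E) : Integrable (fun y => fderiv ℝ f y v) :=
  ((hf.continuous_fderiv one_ne_zero).clm_apply continuous_const).integrable_of_hasCompactSupport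
    ((hc.fderiv (𝕜 := ℝ)).comp_left (g := fun L : E →L[ℝ] ℝ => L v) (by simp))

theorem integral_fderiv_apply_eq_zero {f : E → ℝ} (hf : ContDiff ℝ 1 f)
    (hc : HasCompactSupport f) (v : E) : ∫ y, fderiv ℝ f y v = 0 := by
  -- Integration by parts against the constant function 1, whose derivative vanishes.
  have h := integral_mul_fderiv_eq_neg_fderiv_mul_of_integrable (μ := (volume : Measure E))
    (f := fun _ => (1 : ℝ)) (g := f) (v := v) (by simp)
    (by simpa using integrable_fderiv_apply hf hc v)
    (by simpa using hf.continuous.integrable_of_hasCompactSupport hc)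
    (fun _ _ => by fun_prop) (fun y _ => hf.differentiable one_ne_zero y)
  simpa using h

/-- The divergence theorem for `k X` with `k` compactly supported and `X(y) = b(y - x₀) + v`. -/
theorem integral_fderiv_affine {k : E → ℝ} (hk : ContDiff ℝ 1 k) (hc : HasCompactSupport k)
    (x₀ : E) (b : ℝ) (v : E) :
    ∫ y, (fderiv ℝ k y (b • (y - x₀) + v) + b * Module.finrank ℝ E * k y) = 0 := by
  set e := stdOrthonormalBasis ℝ E
  have hf (i) : ContDiff ℝ 1 (fun y => inner ℝ (e i) (b • (y - x₀) + v) * k y) :=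
    (contDiff_const.inner ℝ (by fun_prop)).mul hk
  have hfc (i) : HasCompactSupport (fun y => inner ℝ (e i) (b • (y - x₀) + v) * k y) :=
    hc.mul_left
  have hd (i) (y : E) : fderiv ℝ (fun y => inner ℝ (e i) (b • (y - x₀) + v) * k y) y (e i)
      = inner ℝ (e i) (b • (y - x₀) + v) * fderiv ℝ k y (e i) + b * k y := by
    have h1 : HasFDerivAt (fun y => inner ℝ (e i) (b • (y - x₀) + v)) (b • innerSL ℝ (e i)) y := by
      have := ((innerSL ℝ (e i)).hasFDerivAt (x := b • (y - x₀) + v)).comp y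
        ((((hasFDerivAt_id y).sub_const x₀).const_smul b).add_const v)
      refine this.congr_fderiv ?_
      ext u
      simp
    rw [fderiv_mul_apply h1.differentiableAt (hk.differentiable one_ne_zero y), h1.fderiv]
    simp
  -- The integrand is div(kX), expanded in an orthonormal basis; div X = b · dim E.
  have hs (y : E) : fderiv ℝ k y (b • (y - x₀) + v) + b * Module.finrank ℝ E * k y
      = ∑ i, fderiv ℝ (fun y => inner ℝ (e i) (b • (y - x₀) + v) * k y) y (e i) := by
    simp_rw [hd, Finset.sum_add_distrib, sum_fderiv_mul_inner]
    simp
    ring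
  simp_rw [hs]
  rw [integral_finsetSum _ fun i _ => integrable_fderiv_apply (hf i) (hfc i) _]
  exact Finset.sum_eq_zero fun i _ => integral_fderiv_apply_eq_zero (hf i) (hfc i) _

/-- Integration by parts for the drift Laplacian `Δ - 2κ (y - x₀)·∇`, symmetric in the weighted
space with weight `gauss x₀ κ`. -/
theorem integral_fderiv_gradient_mul_gauss {w ψ : E → ℝ} (hw : ContDiff ℝ ∞ w)
    (hψ : ContDiff ℝ 1 ψ) (hc : HasCompactSupport ψ) (x₀ : E) (κ : ℝ) :
    ∫ y, (fderiv ℝ ψ y (∇ w y)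
      + (Δ w y - 2 * κ * inner ℝ (y - x₀) (∇ w y)) * ψ y) * gauss x₀ κ y = 0 := by
  set e := stdOrthonormalBasis ℝ E
  have hw1 (v : E) : ContDiff ℝ 1 (fun y => fderiv ℝ w y v) :=
    ((contDiff_fderiv hw).of_le (by simp)).clm_apply contDiff_const
  have hg : ContDiff ℝ 1 (gauss x₀ κ) := contDiff_gauss x₀ κ
  have hf (i) : ContDiff ℝ 1 (fun y => ψ y * (gauss x₀ κ y * fderiv ℝ w y (e i))) :=
    hψ.mul (hg.mul (hw1 _))
  have hfc (i) : HasCompactSupport (fun y => ψ y * (gauss x₀ κ y * fderiv ℝ w y (e i))) :=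
    hc.mul_right
  have hd2 (i) (y : E) : fderiv ℝ (fun y => fderiv ℝ w y (e i)) y (e i) =
      fderiv ℝ (fderiv ℝ w) y (e i) (e i) := by
    rw [fderiv_clm_apply ((contDiff_fderiv hw).differentiable (by simp) y) (by fun_prop)]
    simp
  have hgr (y : E) (i) : fderiv ℝ w y (e i) = inner ℝ (e i) (∇ w y) := by
    rw [real_inner_comm, inner_gradient_left]
  -- The integrand is the divergence of ψ e^{-κ|y - x₀|²} ∇w; differentiating the weight produces
  -- the drift term.
  have hs (y : E) : (fderiv ℝ ψ y (∇ w y)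
      + (Δ w y - 2 * κ * inner ℝ (y - x₀) (∇ w y)) * ψ y) * gauss x₀ κ y
      = ∑ i, fderiv ℝ (fun y => ψ y * (gauss x₀ κ y * fderiv ℝ w y (e i))) y (e i) := by
    have hd (i) : fderiv ℝ (fun y => ψ y * (gauss x₀ κ y * fderiv ℝ w y (e i))) y (e i)
        = ψ y * gauss x₀ κ y * fderiv ℝ (fderiv ℝ w) y (e i) (e i)
          + (-2 * κ * ψ y * gauss x₀ κ y) * (inner ℝ (e i) (∇ w y) * innerSL ℝ (y - x₀) (e i))
          + gauss x₀ κ y * (inner ℝ (e i) (∇ w y) * fderiv ℝ ψ y (e i)) := by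
      have hwd := (hw1 (e i)).differentiable one_ne_zero y
      have hgd := hg.differentiable one_ne_zero y
      rw [fderiv_mul_apply (hψ.differentiable one_ne_zero y) (hgd.fun_mul hwd),
        fderiv_mul_apply hgd hwd, fderiv_gauss_apply, hd2, hgr]
      simp only [innerSL_apply_apply]
      ring
    simp_rw [hd, Finset.sum_add_distrib, ← Finset.mul_sum, sum_fderiv_mul_inner,
      ← laplacian_eq_sum_fderiv]
    simp only [innerSL_apply_apply]
    ring
  simp_rw [hs]
  rw [integral_finsetSum _ fun i _ => integrable_fderiv_apply (hf i) (hfc i) _]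
  exact Finset.sum_eq_zero fun i _ => integral_fderiv_apply_eq_zero (hf i) (hfc i) _

end Divergence

/-! ### Integrability against Gaussians, and cutoff functions -/

section GaussianIntegrability

variable {E : Type*} [NormedAddCommGroup E] [InnerProductSpace ℝ E] [FiniteDimensional ℝ E]
  [MeasurableSpace E] [BorelSpace E]

theorem integrable_gauss (x₀ : E) {ε : ℝ} (hε : 0 < ε) : Integrable (gauss x₀ ε) := by
  have h := (GaussianFourier.integrable_cexp_neg_mul_sq_norm_add (V := E) (b := (ε : ℂ))
    (by simpa using hε) 0 0).norm
  have h2 : Integrable (fun v : E => Real.exp (-ε * ‖v‖ ^ 2)) := by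
    refine h.congr (ae_of_all _ fun v => ?_)
    simp only [Complex.norm_exp]
    norm_cast
    simp
  exact h2.comp_sub_right x₀

/-- Half of the Gaussian absorbs the quadratic weight, by 1 + u ≤ e^u; the other half remains. -/
theorem one_add_sq_mul_gauss_le (x₀ : E) {ε : ℝ} (hε : 0 < ε) (y : E) :
    (1 + ‖y - x₀‖ ^ 2) * gauss x₀ ε y ≤ (1 + 2 / ε) * gauss x₀ (ε / 2) y := by
  have h : gauss x₀ ε y = gauss x₀ (ε / 2) y * gauss x₀ (ε / 2) y := by
    rw [← gauss_add, add_halves]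
  have h1 : (1 + ‖y - x₀‖ ^ 2) * gauss x₀ (ε / 2) y ≤ 1 + 2 / ε := by
    set r := ‖y - x₀‖ ^ 2 with hr
    have hr0 : 0 ≤ r := by positivity
    have hexp : gauss x₀ (ε / 2) y = (Real.exp (ε / 2 * r))⁻¹ := by
      rw [← Real.exp_neg, gauss, hr]
      ring_nf
    have h3 : ε / 2 * r + 1 ≤ Real.exp (ε / 2 * r) := Real.add_one_le_exp _
    rw [hexp, ← div_eq_mul_inv, div_le_iff₀ (Real.exp_pos _)]
    have h4 : (1 + 2 / ε) * (ε / 2 * r + 1) = 1 + r + (ε / 2 * r + 2 / ε) := by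
      field_simp
      ring
    have h5 : 0 ≤ ε / 2 * r + 2 / ε := by positivity
    have h6 : (1 + 2 / ε) * (ε / 2 * r + 1) ≤ (1 + 2 / ε) * Real.exp (ε / 2 * r) := by
      gcongr
    linarith
  rw [h, ← mul_assoc]
  exact mul_le_mul_of_nonneg_right h1 (gauss_pos _ _ _).le

/-- Continuous functions that are integrable against every centred Gaussian. -/
structure GaussInt (x₀ : E) (f : E → ℝ) : Prop where
  continuous : Continuous f
  integrable : ∀ ε > 0, Integrable (fun y => f y * gauss x₀ ε y)

namespace GaussInt

variable {x₀ : E} {f g : E → ℝ}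

theorem const (x₀ : E) (c : ℝ) : GaussInt x₀ (fun _ => c) :=
  ⟨continuous_const, fun _ hε => (integrable_gauss x₀ hε).const_mul c⟩

theorem add (hf : GaussInt x₀ f) (hg : GaussInt x₀ g) : GaussInt x₀ (fun y => f y + g y) :=
  ⟨hf.continuous.add hg.continuous, fun ε hε => by
    simp only [add_mul]
    exact (hf.integrable ε hε).add (hg.integrable ε hε)⟩

/-- A quadratic factor costs only a halving of the Gaussian rate, which is harmless because
integrability is required for every rate. -/
theorem of_le (hg : GaussInt x₀ g) (hf : Continuous f) (C : ℝ)
    (h : ∀ y, |f y| ≤ C * ((1 + ‖y - x₀‖ ^ 2) * |g y|)) : GaussInt x₀ f := by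
  refine ⟨hf, fun ε hε => ?_⟩
  refine Integrable.mono' (((hg.integrable (ε / 2) (half_pos hε)).norm).const_mul
    (|C| * (1 + 2 / ε))) (hf.mul (continuous_gauss _ _)).aestronglyMeasurable
    (ae_of_all _ fun y => ?_)
  have hg1 := gauss_pos x₀ ε y
  have hg2 := gauss_pos x₀ (ε / 2) y
  rw [Real.norm_eq_abs, Real.norm_eq_abs, abs_mul, abs_mul, abs_of_pos hg1, abs_of_pos hg2]
  calc |f y| * gauss x₀ ε y
      ≤ |C| * ((1 + ‖y - x₀‖ ^ 2) * |g y|) * gauss x₀ ε y := by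
        gcongr
        exact (h y).trans (by gcongr; exact le_abs_self C)
    _ = |C| * |g y| * ((1 + ‖y - x₀‖ ^ 2) * gauss x₀ ε y) := by ring
    _ ≤ |C| * |g y| * ((1 + 2 / ε) * gauss x₀ (ε / 2) y) := by
        exact mul_le_mul_of_nonneg_left (one_add_sq_mul_gauss_le x₀ hε y) (by positivity)
    _ = _ := by ring

theorem of_bdd (hf : Continuous f) (C : ℝ) (h : ∀ y, |f y| ≤ C * (1 + ‖y - x₀‖ ^ 2)) :
    GaussInt x₀ f :=
  (const x₀ 1).of_le hf C (by simpa using h)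

theorem mul_le (hf : GaussInt x₀ f) (hg : Continuous g) (C : ℝ)
    (h : ∀ y, |g y| ≤ C * (1 + ‖y - x₀‖ ^ 2)) : GaussInt x₀ (fun y => g y * f y) :=
  hf.of_le (hg.mul hf.continuous) C fun y => by
    rw [abs_mul, ← mul_assoc]
    exact mul_le_mul_of_nonneg_right (h y) (abs_nonneg _)

theorem const_mul (hf : GaussInt x₀ f) (c : ℝ) : GaussInt x₀ (fun y => c * f y) :=
  ⟨continuous_const.mul hf.continuous, fun ε hε => by
    simpa only [mul_assoc] using (hf.integrable ε hε).const_mul c⟩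

theorem sub (hf : GaussInt x₀ f) (hg : GaussInt x₀ g) : GaussInt x₀ (fun y => f y - g y) := by
  simpa [sub_eq_add_neg] using hf.add (hg.const_mul (-1))

end GaussInt

/-- Smooth cutoff functions exhausting the space, with gradients tending to `0` uniformly. -/
theorem exists_cutoff (x₀ : E) : ∃ (χ : ℕ → E → ℝ) (C : ℝ), 0 ≤ C ∧
    (∀ k, ContDiff ℝ ∞ (χ k)) ∧ (∀ k, HasCompactSupport (χ k)) ∧
    (∀ k y, 0 ≤ χ k y) ∧ (∀ k y, χ k y ≤ 1) ∧
    (∀ (k : ℕ) (y : E), ‖y - x₀‖ ≤ k → χ k y = 1) ∧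
    (∀ (k : ℕ) (y v : E), |fderiv ℝ (χ k) y v| ≤ C / (k + 1) * ‖v‖) := by
  let b : ContDiffBump (0 : E) := ⟨1, 2, one_pos, one_lt_two⟩
  have hb1 : ContDiff ℝ 1 b := b.contDiff
  obtain ⟨C, hC⟩ := (b.hasCompactSupport.fderiv (𝕜 := ℝ)).exists_bound_of_continuous
    (hb1.continuous_fderiv one_ne_zero)
  have hpos (k : ℕ) : (0 : ℝ) < k + 1 := by positivity
  have hC0 : 0 ≤ C := (norm_nonneg _).trans (hC 0)
  -- Dilating by k + 1 rather than k also covers k = 0, and gives gradients of size C/(k + 1).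
  refine ⟨fun k y => b (((k : ℝ) + 1)⁻¹ • (y - x₀)), C, hC0, fun k => ?_, fun k => ?_,
    fun k y => b.nonneg, fun k y => b.le_one, fun k y hy => ?_, fun k y v => ?_⟩
  · exact b.contDiff.comp (contDiff_const.smul (contDiff_id.sub contDiff_const))
  · have hh := b.hasCompactSupport.comp_homeomorph
      ((Homeomorph.subRight x₀).trans (Homeomorph.smulOfNeZero ((k : ℝ) + 1)⁻¹
        (inv_ne_zero (hpos k).ne')))
    exact hh
  · refine b.one_of_mem_closedBall ?_
    rw [mem_closedBall_zero_iff, norm_smul, norm_inv, Real.norm_of_nonneg (hpos k).le,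
      inv_mul_le_iff₀ (hpos k)]
    simp only [b]
    linarith
  · have hA : HasFDerivAt (fun y : E => ((k : ℝ) + 1)⁻¹ • (y - x₀))
        (((k : ℝ) + 1)⁻¹ • ContinuousLinearMap.id ℝ E) y :=
      ((hasFDerivAt_id y).sub_const x₀).const_smul _
    have hB := ((hb1.differentiable one_ne_zero _).hasFDerivAt).comp y hA
    have hv : fderiv ℝ (fun y => b (((k : ℝ) + 1)⁻¹ • (y - x₀))) y v
        = ((k : ℝ) + 1)⁻¹ * fderiv ℝ b (((k : ℝ) + 1)⁻¹ • (y - x₀)) v := by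
      rw [show (fun y => b (((k : ℝ) + 1)⁻¹ • (y - x₀)))
        = b ∘ (fun y : E => ((k : ℝ) + 1)⁻¹ • (y - x₀)) from rfl, hB.fderiv]
      simp
    rw [hv, abs_mul, abs_of_pos (inv_pos.2 (hpos k)), div_eq_inv_mul, mul_assoc]
    gcongr
    exact ContinuousLinearMap.le_of_opNorm_le _ (hC _) v

theorem tendsto_cutoff {x₀ : E} {χ : ℕ → E → ℝ}
    (h : ∀ (k : ℕ) (y : E), ‖y - x₀‖ ≤ k → χ k y = 1) (y : E) :
    Tendsto (fun k => χ k y) atTop (𝓝 1) := by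
  obtain ⟨N, hN⟩ := exists_nat_ge ‖y - x₀‖
  refine tendsto_const_nhds.congr' ?_
  filter_upwards [eventually_ge_atTop N] with k hk
  exact (h k y (hN.trans (by exact_mod_cast hk))).symm

end GaussianIntegrability

/-! ### Weak form of the equation and the Caccioppoli estimate -/

section ProfileIdentities

variable {E : Type*} [NormedAddCommGroup E] [InnerProductSpace ℝ E] [FiniteDimensional ℝ E]
  [MeasurableSpace E] [BorelSpace E]

/-- Weak form of `Δw - 2κ (y - x₀)·∇w + N(w) = 0`. -/
theorem integral_weak_form {w ψ : E → ℝ} {N : ℝ → ℝ} {x₀ : E} {κ : ℝ} (hw : ContDiff ℝ ∞ w)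
    (heq : ∀ y, Δ w y - 2 * κ * inner ℝ (y - x₀) (∇ w y) + N (w y) = 0)
    (hψ : ContDiff ℝ 1 ψ) (hc : HasCompactSupport ψ) :
    ∫ y, (fderiv ℝ ψ y (∇ w y) - N (w y) * ψ y) * gauss x₀ κ y = 0 := by
  rw [← integral_fderiv_gradient_mul_gauss hw hψ hc x₀ κ]
  refine integral_congr_ae (ae_of_all _ fun y => ?_)
  have h := heq y
  have h1 : Δ w y - 2 * κ * inner ℝ (y - x₀) (∇ w y) = -N (w y) := by linarith
  simp only [h1]
  ring

theorem continuous_gradient {w : E → ℝ} (hw : ContDiff ℝ ∞ w) : Continuous (∇ w) :=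
  (contDiff_gradient hw).continuous

/-- A Caccioppoli estimate: bounded solutions have gradients that are square integrable against
every Gaussian. -/
theorem gaussInt_norm_gradient_sq {w : E → ℝ} {N : ℝ → ℝ} {x₀ : E} {κ M : ℝ}
    (hw : ContDiff ℝ ∞ w) (hN : Continuous N) (hM : ∀ y, |w y| ≤ M)
    (heq : ∀ y, Δ w y - 2 * κ * inner ℝ (y - x₀) (∇ w y) + N (w y) = 0) :
    GaussInt x₀ (fun y => ‖∇ w y‖ ^ 2) := by
  have hgc := continuous_gradient hw
  refine ⟨hgc.norm.pow 2, fun ε hε => ?_⟩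
  obtain ⟨K, hK⟩ := (isCompact_Icc (a := -M) (b := M)).exists_bound_of_continuousOn hN.continuousOn
  have hM0 : 0 ≤ M := (abs_nonneg _).trans (hM x₀)
  have hK0 : 0 ≤ K := (norm_nonneg _).trans (hK M ⟨by linarith, le_rfl⟩)
  have hKN (y) : |N (w y)| ≤ K := hK _ (abs_le.1 (hM y))
  obtain ⟨χ, C, hC0, hχ, hχc, hχ0, hχ1, hχe, hχd⟩ := exists_cutoff x₀
  -- The equation carries the weight of rate κ. An extra factor of rate δ in the test function turns
  -- it into the desired rate ε; δ may be negative, so this factor may grow, but the cutoff keeps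
  -- the support compact.
  set δ := ε - κ with hδ
  -- The remainders of two applications of Young's inequality (cutoff gradient, drift), plus a bound
  -- for N(w)w. It does not depend on the cutoff index.
  set B : E → ℝ := fun y => (4 * (C * M) ^ 2 + 4 * (δ * M) ^ 2 * ‖y - x₀‖ ^ 2 + K * M) with hB
  have hBi : Integrable (fun y => B y * gauss x₀ ε y) := by
    refine (GaussInt.of_bdd (by fun_prop) (4 * (C * M) ^ 2 + 4 * (δ * M) ^ 2 + K * M)
      fun y => ?_).integrable ε hε
    rw [abs_of_nonneg (by positivity)]
    have := sq_nonneg ‖y - x₀‖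
    have h1 : 0 ≤ (4 * (C * M) ^ 2 + K * M) * ‖y - x₀‖ ^ 2 := by positivity
    have h2 : 0 ≤ 4 * (δ * M) ^ 2 := by positivity
    simp only [hB]
    linarith
  have hφ : AECover (volume : Measure E) atTop (fun k : ℕ => Metric.closedBall x₀ (k : ℝ)) :=
    aecover_closedBall tendsto_natCast_atTop_atTop
  have hcont : Continuous (fun y => ‖∇ w y‖ ^ 2 * gauss x₀ ε y) :=
    (hgc.norm.pow 2).mul (continuous_gauss _ _)
  -- It suffices to bound the integrals over the balls of radius k uniformly in k, and χ k = 1 on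
  -- such a ball.
  refine hφ.integrable_of_integral_norm_bounded (2 * ∫ y, B y * gauss x₀ ε y)
    (fun k => hcont.continuousOn.integrableOn_compact (isCompact_closedBall _ _))
    (Eventually.of_forall fun k => ?_)

  have hw1 : ContDiff ℝ 1 w := hw.of_le (by simp)
  have hχk1 : ContDiff ℝ 1 (χ k) := (hχ k).of_le (by simp)
  have hg1 : ContDiff ℝ 1 (gauss x₀ δ) := contDiff_gauss _ _
  -- The test function is χ² e^{-δ|y - x₀|²} w. The square leaves a factor χ beside ∇χ·∇w, so that
  -- this term can be absorbed into χ²|∇w|².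
  have hψ : ContDiff ℝ 1 (fun y => χ k y * (χ k y * (gauss x₀ δ y * w y))) :=
    hχk1.mul (hχk1.mul (hg1.mul hw1))
  have hψc : HasCompactSupport (fun y => χ k y * (χ k y * (gauss x₀ δ y * w y))) :=
    (hχc k).mul_right
  have hweak := integral_weak_form hw heq hψ hψc
  have hexp (y : E) : (fderiv ℝ (fun y => χ k y * (χ k y * (gauss x₀ δ y * w y))) y (∇ w y)
      - N (w y) * (χ k y * (χ k y * (gauss x₀ δ y * w y)))) * gauss x₀ κ y
      = (χ k y ^ 2 * ‖∇ w y‖ ^ 2 + 2 * χ k y * w y * fderiv ℝ (χ k) y (∇ w y)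
        - 2 * δ * χ k y ^ 2 * w y * inner ℝ (y - x₀) (∇ w y)
        - N (w y) * w y * χ k y ^ 2) * gauss x₀ ε y := by
    have hwd := hw1.differentiable one_ne_zero y
    have hgd := hg1.differentiable one_ne_zero y
    have hχd := hχk1.differentiable one_ne_zero y
    have hsplit : gauss x₀ ε y = gauss x₀ δ y * gauss x₀ κ y := by
      rw [← gauss_add, hδ, sub_add_cancel]
    rw [fderiv_mul_apply hχd (hχd.fun_mul (hgd.fun_mul hwd)),
      fderiv_mul_apply hχd (hgd.fun_mul hwd), fderiv_mul_apply hgd hwd, fderiv_gauss_apply,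
      ← inner_gradient_left (f := w), real_inner_self_eq_norm_sq, hsplit]
    ring
  simp_rw [hexp] at hweak
  have hcχ : Continuous (χ k) := (hχ k).continuous
  have hint1 : Integrable (fun y => (χ k y ^ 2 * ‖∇ w y‖ ^ 2
        + 2 * χ k y * w y * fderiv ℝ (χ k) y (∇ w y)
        - 2 * δ * χ k y ^ 2 * w y * inner ℝ (y - x₀) (∇ w y)
        - N (w y) * w y * χ k y ^ 2) * gauss x₀ ε y) := by
    have hcd : Continuous (fderiv ℝ (χ k)) := hχk1.continuous_fderiv one_ne_zero
    have hcw := hw.continuous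
    have hcg := continuous_gauss x₀ ε
    refine Continuous.integrable_of_hasCompactSupport (by fun_prop) ?_
    have : (fun y => (χ k y ^ 2 * ‖∇ w y‖ ^ 2
        + 2 * χ k y * w y * fderiv ℝ (χ k) y (∇ w y)
        - 2 * δ * χ k y ^ 2 * w y * inner ℝ (y - x₀) (∇ w y)
        - N (w y) * w y * χ k y ^ 2) * gauss x₀ ε y) = fun y => χ k y * ((χ k y * ‖∇ w y‖ ^ 2
        + 2 * w y * fderiv ℝ (χ k) y (∇ w y)
        - 2 * δ * χ k y * w y * inner ℝ (y - x₀) (∇ w y)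
        - N (w y) * w y * χ k y) * gauss x₀ ε y) := by
      ext y
      ring
    rw [this]
    exact (hχc k).mul_right
  have hint2 : Integrable (fun y => χ k y ^ 2 * ‖∇ w y‖ ^ 2 * gauss x₀ ε y) := by
    have hcg := continuous_gauss x₀ ε
    refine Continuous.integrable_of_hasCompactSupport (by fun_prop) ?_
    have : (fun y => χ k y ^ 2 * ‖∇ w y‖ ^ 2 * gauss x₀ ε y)
        = fun y => χ k y * (χ k y * ‖∇ w y‖ ^ 2 * gauss x₀ ε y) := by
      ext y
      ring
    rw [this]
    exact (hχc k).mul_right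
  have hpt (y : E) : 1 / 2 * (χ k y ^ 2 * ‖∇ w y‖ ^ 2 * gauss x₀ ε y)
      ≤ (χ k y ^ 2 * ‖∇ w y‖ ^ 2 + 2 * χ k y * w y * fderiv ℝ (χ k) y (∇ w y)
        - 2 * δ * χ k y ^ 2 * w y * inner ℝ (y - x₀) (∇ w y)
        - N (w y) * w y * χ k y ^ 2) * gauss x₀ ε y + B y * gauss x₀ ε y := by
    rw [← add_mul, ← mul_assoc]
    refine mul_le_mul_of_nonneg_right ?_ (gauss_pos _ _ _).le
    have hd : |w y * fderiv ℝ (χ k) y (∇ w y)| ≤ C * M * ‖∇ w y‖ := by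
      rw [abs_mul]
      have h1 : C / (k + 1) ≤ C := div_le_self hC0 (by linarith [Nat.cast_nonneg (α := ℝ) k])
      calc |w y| * |fderiv ℝ (χ k) y (∇ w y)| ≤ M * (C * ‖∇ w y‖) := by
            gcongr
            · exact hM y
            · exact (hχd k y _).trans (by gcongr)
        _ = _ := by ring
    have hi : |δ * w y * inner ℝ (y - x₀) (∇ w y)| ≤ |δ| * M * (‖y - x₀‖ * ‖∇ w y‖) := by
      rw [abs_mul, abs_mul]
      gcongr
      · exact hM y
      · exact abs_real_inner_le_norm _ _
    have hn : |N (w y) * w y| ≤ K * M := by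
      rw [abs_mul]
      gcongr
      · exact hKN y
      · exact hM y
    have hχk0 := hχ0 k y
    have hχk1 := hχ1 k y
    have hsq : χ k y ^ 2 ≤ 1 := pow_le_one₀ hχk0 hχk1
    have hsq0 : 0 ≤ χ k y ^ 2 := sq_nonneg _
    have e1 : -(χ k y * (C * M * ‖∇ w y‖)) ≤ χ k y * (w y * fderiv ℝ (χ k) y (∇ w y)) := by
      rw [← mul_neg]
      exact mul_le_mul_of_nonneg_left (neg_le_of_abs_le hd) hχk0
    have e2 : χ k y ^ 2 * (δ * w y * inner ℝ (y - x₀) (∇ w y))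
        ≤ χ k y ^ 2 * (|δ| * M * (‖y - x₀‖ * ‖∇ w y‖)) :=
      mul_le_mul_of_nonneg_left ((le_abs_self _).trans hi) hsq0
    have e3 : N (w y) * w y * χ k y ^ 2 ≤ K * M :=
      (mul_le_mul_of_nonneg_right ((le_abs_self _).trans hn) hsq0).trans
        (mul_le_of_le_one_right (by positivity) hsq)
    -- Expanded, these squares are the two Young inequalities; each uses up a quarter of χ²|∇w|², so
    -- one half survives.
    have e4 : 0 ≤ (1 / 2 * (χ k y * ‖∇ w y‖) - 2 * (C * M)) ^ 2 := sq_nonneg _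
    have e5 : 0 ≤ χ k y ^ 2 * (1 / 2 * ‖∇ w y‖ - 2 * (|δ| * M * ‖y - x₀‖)) ^ 2 := by positivity
    have e6 : χ k y ^ 2 * (4 * (|δ| * M * ‖y - x₀‖) ^ 2) ≤ 1 * (4 * (|δ| * M * ‖y - x₀‖) ^ 2) := by
      gcongr
    have e7 : (|δ| * M * ‖y - x₀‖) ^ 2 = (δ * M) ^ 2 * ‖y - x₀‖ ^ 2 := by
      rw [mul_pow, mul_pow, sq_abs, mul_pow]
    have e8 : 0 ≤ (C * M) ^ 2 := sq_nonneg _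
    simp only [hB]
    nlinarith [e1, e2, e3, e4, e5, e6, e7]
  have hmain : 1 / 2 * ∫ y, χ k y ^ 2 * ‖∇ w y‖ ^ 2 * gauss x₀ ε y ≤ ∫ y, B y * gauss x₀ ε y := by
    rw [← integral_const_mul]
    refine (integral_mono (hint2.const_mul _) (hint1.add hBi) hpt).trans_eq ?_
    rw [integral_add' hint1 hBi, hweak, zero_add]
  calc ∫ y in Metric.closedBall x₀ (k : ℝ), ‖‖∇ w y‖ ^ 2 * gauss x₀ ε y‖
      = ∫ y in Metric.closedBall x₀ (k : ℝ), χ k y ^ 2 * ‖∇ w y‖ ^ 2 * gauss x₀ ε y := by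
        refine setIntegral_congr_fun Metric.isClosed_closedBall.measurableSet fun y hy => ?_
        have hg := gauss_pos x₀ ε y
        simp only [hχe k y (by simpa [dist_eq_norm] using hy)]
        rw [Real.norm_of_nonneg (by positivity)]
        ring
    _ ≤ ∫ y, χ k y ^ 2 * ‖∇ w y‖ ^ 2 * gauss x₀ ε y :=
        setIntegral_le_integral hint2 (ae_of_all _ fun y =>
          mul_nonneg (by positivity) (gauss_pos _ _ _).le)
    _ ≤ _ := by linarith

end ProfileIdentities

/-! ### Pohozaev identity for translations and dilations -/

section Pohozaev

variable {E : Type*} [NormedAddCommGroup E] [InnerProductSpace ℝ E] [FiniteDimensional ℝ E]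

theorem inner_fderiv_gradient {w : E → ℝ} (hw : ContDiff ℝ ∞ w) (y u v : E) :
    inner ℝ (fderiv ℝ (∇ w) y u) v = fderiv ℝ (fderiv ℝ w) y u v := by
  have h : (fun x => inner ℝ (∇ w x) v) = fun x => fderiv ℝ w x v := by
    ext x
    exact inner_gradient_left
  have h1 := congrArg (fun f => fderiv ℝ f y u) h
  rw [fderiv_inner_apply ℝ ((contDiff_gradient hw).differentiable (by simp) y) (by fun_prop),
    fderiv_clm_apply ((contDiff_fderiv hw).differentiable (by simp) y) (by fun_prop)] at h1
  simpa using h1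

/-- Symmetry of the Hessian, which makes the second-order terms cancel in the Pohozaev identity. -/
theorem inner_fderiv_gradient_comm {w : E → ℝ} (hw : ContDiff ℝ ∞ w) (y u v : E) :
    inner ℝ (fderiv ℝ (∇ w) y u) v = inner ℝ u (fderiv ℝ (∇ w) y v) := by
  rw [inner_fderiv_gradient hw, real_inner_comm, inner_fderiv_gradient hw]
  exact (hw.contDiffAt.isSymmSndFDerivAt (by simpa using ENat.LEInfty.out)).eq u v

/-- Off the topological support of ψ, both ψ and its derivative vanish. This serves integrands built
from ψ and its derivative. -/
theorem _root_.HasCompactSupport.of_fderiv {ψ f : E → ℝ} (hψ : HasCompactSupport ψ)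
    (h : ∀ y, ψ y = 0 → fderiv ℝ ψ y = 0 → f y = 0) : HasCompactSupport f :=
  .intro hψ fun y hy => h y (image_eq_zero_of_notMem_tsupport hy)
    (Function.notMem_support.1 fun hy' => hy (support_fderiv_subset ℝ hy'))

variable [MeasurableSpace E] [BorelSpace E]

/-- Pohozaev identity: the equation `Δw - 2κ (y - x₀)·∇w + N(w) = 0` tested against
`α w + X·∇w`, where `X(y) = b(y - x₀) + v` and `P' = N`. -/
theorem integral_pohozaev {w : E → ℝ} {N P : ℝ → ℝ} {x₀ : E} {κ M : ℝ} (hκ : 0 < κ)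
    (hw : ContDiff ℝ ∞ w) (hN : Continuous N) (hP : ∀ x, HasDerivAt P (N x) x)
    (hM : ∀ y, |w y| ≤ M)
    (heq : ∀ y, Δ w y - 2 * κ * inner ℝ (y - x₀) (∇ w y) + N (w y) = 0) (α b : ℝ) (v : E) :
    Integrable (fun y => ((α + b) * ‖∇ w y‖ ^ 2 - α * (N (w y) * w y)
      + (-2 * κ * inner ℝ (y - x₀) (b • (y - x₀) + v) + b * Module.finrank ℝ E)
        * (P (w y) - 1 / 2 * ‖∇ w y‖ ^ 2)) * gauss x₀ κ y) ∧
    ∫ y, ((α + b) * ‖∇ w y‖ ^ 2 - α * (N (w y) * w y)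
      + (-2 * κ * inner ℝ (y - x₀) (b • (y - x₀) + v) + b * Module.finrank ℝ E)
        * (P (w y) - 1 / 2 * ‖∇ w y‖ ^ 2)) * gauss x₀ κ y = 0 := by
  have hq := gaussInt_norm_gradient_sq hw hN hM heq
  have hgc := continuous_gradient hw
  have hwc := hw.continuous
  have hPd : ContDiff ℝ 1 P := by
    rw [contDiff_one_iff_deriv]
    refine ⟨fun x => (hP x).differentiableAt, ?_⟩
    rwa [show deriv P = N from funext fun x => (hP x).deriv]
  have hPc := hPd.continuous
  obtain ⟨K, hK⟩ := (isCompact_Icc (a := -M) (b := M)).exists_bound_of_continuousOn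
    (hN.mul continuous_id).continuousOn
  obtain ⟨L, hL⟩ := (isCompact_Icc (a := -M) (b := M)).exists_bound_of_continuousOn
    hPc.continuousOn
  have hM0 : 0 ≤ M := (abs_nonneg _).trans (hM x₀)
  have hL0 : 0 ≤ L := (norm_nonneg _).trans (hL M ⟨by linarith, le_rfl⟩)
  have hK0 : 0 ≤ K := (norm_nonneg _).trans (hK M ⟨by linarith, le_rfl⟩)
  set X : E → E := fun y => b • (y - x₀) + v with hX
  set m : E → ℝ := fun y => α * w y + inner ℝ (∇ w y) (X y) with hm
  -- The derivative of R along X is N(w) X·∇w minus a Hessian term, matching what the multiplier m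
  -- produces with the opposite sign.
  set R : E → ℝ := fun y => P (w y) - 1 / 2 * ‖∇ w y‖ ^ 2 with hR
  set S : E → ℝ := fun y => (α + b) * ‖∇ w y‖ ^ 2 - α * (N (w y) * w y)
      + (-2 * κ * inner ℝ (y - x₀) (X y) + b * Module.finrank ℝ E) * R y with hS
  have hXc : Continuous X := by fun_prop
  have hXle (y) : ‖X y‖ ≤ (|b| + ‖v‖) * (1 + ‖y - x₀‖ ^ 2) := by
    have h1 : ‖X y‖ ≤ |b| * ‖y - x₀‖ + ‖v‖ := by
      simpa [hX, norm_smul] using norm_add_le (b • (y - x₀)) v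
    have h2 : ‖y - x₀‖ ≤ 1 + ‖y - x₀‖ ^ 2 := by nlinarith [sq_nonneg (‖y - x₀‖ - 1)]
    have h3 : |b| * ‖y - x₀‖ ≤ |b| * (1 + ‖y - x₀‖ ^ 2) := by gcongr
    have h4 : 0 ≤ ‖v‖ * ‖y - x₀‖ ^ 2 := by positivity
    linarith
  -- integrability of the limit and of the dominating function
  have hPG : GaussInt x₀ (fun y => P (w y)) :=
    .of_bdd (by fun_prop) L fun y => by
      have : |P (w y)| ≤ L := hL _ (abs_le.1 (hM y))
      nlinarith [sq_nonneg ‖y - x₀‖]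
  have hRG : GaussInt x₀ R := hPG.sub (hq.const_mul (1 / 2))
  have hNG : GaussInt x₀ (fun y => N (w y) * w y) :=
    .of_bdd (by fun_prop) K fun y => by
      have : |N (w y) * w y| ≤ K := hK _ (abs_le.1 (hM y))
      nlinarith [sq_nonneg ‖y - x₀‖]
  have hSG : GaussInt x₀ S := by
    refine ((hq.const_mul _).sub (hNG.const_mul _)).add (hRG.mul_le (by fun_prop)
      (2 * κ * (|b| + ‖v‖) + |b| * Module.finrank ℝ E) fun y => ?_)
    have h1 : |inner ℝ (y - x₀) (X y)| ≤ (|b| + ‖v‖) * (1 + ‖y - x₀‖ ^ 2) := by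
      have h3 : |inner ℝ (y - x₀) (X y)| ≤ ‖y - x₀‖ * (|b| * ‖y - x₀‖ + ‖v‖) :=
        (abs_real_inner_le_norm _ _).trans (by
          gcongr
          simpa [hX, norm_smul] using norm_add_le (b • (y - x₀)) v)
      have h2 : ‖y - x₀‖ ≤ 1 + ‖y - x₀‖ ^ 2 := by nlinarith [sq_nonneg (‖y - x₀‖ - 1)]
      have h4 : ‖v‖ * ‖y - x₀‖ ≤ ‖v‖ * (1 + ‖y - x₀‖ ^ 2) := by gcongr
      linarith [abs_nonneg b]
    calc |-2 * κ * inner ℝ (y - x₀) (X y) + b * Module.finrank ℝ E|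
        ≤ |-2 * κ * inner ℝ (y - x₀) (X y)| + |b * Module.finrank ℝ E| := abs_add_le _ _
      _ = 2 * κ * |inner ℝ (y - x₀) (X y)| + |b| * Module.finrank ℝ E := by
          rw [abs_mul, abs_mul, abs_mul, abs_neg, abs_of_pos hκ]
          simp
      _ ≤ 2 * κ * ((|b| + ‖v‖) * (1 + ‖y - x₀‖ ^ 2))
          + |b| * Module.finrank ℝ E * (1 + ‖y - x₀‖ ^ 2) := by
          refine add_le_add (by gcongr) (le_mul_of_one_le_right (by positivity) ?_)
          linarith [sq_nonneg ‖y - x₀‖]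
      _ = _ := by ring
  have hmG : GaussInt x₀ (fun y => ‖∇ w y‖ * |m y|) := by
    refine ((GaussInt.const x₀ 1).add hq).of_le (by fun_prop) (|α| * M + (|b| + ‖v‖)) fun y => ?_
    have h1 : |m y| ≤ |α| * M + ‖∇ w y‖ * ‖X y‖ := by
      refine (abs_add_le _ _).trans (add_le_add ?_ (abs_real_inner_le_norm _ _))
      rw [abs_mul]
      gcongr
      exact hM y
    have h2 : ‖∇ w y‖ ≤ 1 + ‖∇ w y‖ ^ 2 := by nlinarith [sq_nonneg (‖∇ w y‖ - 1)]
    have h3 := hXle y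
    rw [abs_of_nonneg (a := ‖∇ w y‖ * |m y|) (by positivity),
      abs_of_nonneg (a := 1 + ‖∇ w y‖ ^ 2) (by positivity)]
    calc ‖∇ w y‖ * |m y| ≤ ‖∇ w y‖ * (|α| * M + ‖∇ w y‖ * ‖X y‖) := by gcongr
      _ = |α| * M * (1 * ‖∇ w y‖) + ‖X y‖ * ‖∇ w y‖ ^ 2 := by ring
      _ ≤ |α| * M * ((1 + ‖y - x₀‖ ^ 2) * (1 + ‖∇ w y‖ ^ 2))
          + (|b| + ‖v‖) * (1 + ‖y - x₀‖ ^ 2) * (1 + ‖∇ w y‖ ^ 2) := by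
          gcongr
          · linarith [sq_nonneg ‖y - x₀‖]
          · linarith
      _ = _ := by ring
  have hXG : GaussInt x₀ (fun y => ‖X y‖ * |R y|) :=
    GaussInt.mul_le (f := fun y => |R y|)
      (hRG.of_le hRG.continuous.abs 1 fun y => by
        rw [abs_abs, one_mul]
        exact le_mul_of_one_le_left (abs_nonneg _) (by linarith [sq_nonneg ‖y - x₀‖]))
      hXc.norm _ fun y => by simpa using hXle y
  obtain ⟨χ, C, hC0, hχ, hχc, hχ0, hχ1, hχe, hχd⟩ := exists_cutoff x₀
  set T : ℕ → E → ℝ := fun k y => (fderiv ℝ (χ k) y (∇ w y) * m y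
    + fderiv ℝ (χ k) y (X y) * R y + χ k y * S y) * gauss x₀ κ y with hT
  have hRc := hRG.continuous
  have hSc := hSG.continuous
  have hGc := continuous_gauss x₀ κ
  have hgr1 : ContDiff ℝ 1 (∇ w) := (contDiff_gradient hw).of_le (by simp)
  have hw1 : ContDiff ℝ 1 w := hw.of_le (by simp)
  have hX1 : ContDiff ℝ 1 X := by fun_prop
  have hm1 : ContDiff ℝ 1 m := (contDiff_const.mul hw1).add (hgr1.inner ℝ hX1)
  have hR1 : ContDiff ℝ 1 R := (hPd.comp hw1).sub (contDiff_const.mul (hgr1.norm_sq ℝ))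
  have hG1 : ContDiff ℝ 1 (gauss x₀ κ) := contDiff_gauss _ _
  -- T k is the sum of two integrands of zero integral: the weak form tested against χm, and the
  -- divergence of χ e^{-κ|y - x₀|²} R X.
  have hzero (k : ℕ) : ∫ y, T k y = 0 := by
    have hχk1 : ContDiff ℝ 1 (χ k) := (hχ k).of_le (by simp)
    have hψ1 : ContDiff ℝ 1 (fun y => χ k y * m y) := hχk1.mul hm1
    have hψc : HasCompactSupport (fun y => χ k y * m y) := (hχc k).mul_right
    have hk1 : ContDiff ℝ 1 (fun y => χ k y * (gauss x₀ κ y * R y)) := hχk1.mul (hG1.mul hR1)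
    have hkc : HasCompactSupport (fun y => χ k y * (gauss x₀ κ y * R y)) := (hχc k).mul_right
    have hA := integral_weak_form hw heq hψ1 hψc
    have hB := integral_fderiv_affine hk1 hkc x₀ b v
    have hψd := hψ1.continuous_fderiv one_ne_zero
    have hkd := hk1.continuous_fderiv one_ne_zero
    have hχkc := (hχ k).continuous
    have hmc := hm1.continuous
    have hAi : Integrable (fun y => (fderiv ℝ (fun y => χ k y * m y) y (∇ w y)
        - N (w y) * (χ k y * m y)) * gauss x₀ κ y) := by
      refine Continuous.integrable_of_hasCompactSupport (by fun_prop) (hψc.of_fderiv ?_)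
      intro y h1 h2
      rw [h1, h2]
      simp
    have hBi : Integrable (fun y => (fderiv ℝ (fun y => χ k y * (gauss x₀ κ y * R y)) y
        (b • (y - x₀) + v) + b * Module.finrank ℝ E * (χ k y * (gauss x₀ κ y * R y)))) := by
      refine Continuous.integrable_of_hasCompactSupport (by fun_prop) (hkc.of_fderiv ?_)
      intro y h1 h2
      rw [h1, h2]
      simp
    have hsum := integral_add hAi hBi
    rw [hA, hB, add_zero] at hsum
    rw [← hsum]
    refine integral_congr_ae (ae_of_all _ fun y => ?_)
    have hχy := hχk1.differentiable one_ne_zero y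
    have hwy := hw1.differentiable one_ne_zero y
    have hgy := hgr1.differentiable one_ne_zero y
    have hXd : HasFDerivAt X (b • ContinuousLinearMap.id ℝ E) y :=
      (((hasFDerivAt_id y).sub_const x₀).const_smul b).add_const v
    -- The Hessian term D²w(X, ∇w) enters here with a plus sign and in `hRd` with a minus sign.
    -- After it cancels only first derivatives remain, so no bound on D²w is needed.
    have hmd : fderiv ℝ m y (∇ w y) = (α + b) * ‖∇ w y‖ ^ 2
        + inner ℝ (∇ w y) (fderiv ℝ (∇ w) y (X y)) := by
      have h1 : HasFDerivAt m _ y := (hwy.hasFDerivAt.const_mul α).add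
        (hgy.hasFDerivAt.inner ℝ hXd)
      rw [h1.fderiv, add_apply, smul_apply, ContinuousLinearMap.comp_apply,
        ContinuousLinearMap.prod_apply, fderivInnerCLM_apply, smul_apply,
        ContinuousLinearMap.id_apply, inner_smul_right, ← inner_gradient_left (f := w), smul_eq_mul]
      rw [inner_fderiv_gradient_comm hw, real_inner_self_eq_norm_sq]
      ring
    have hRd : fderiv ℝ R y (X y) = N (w y) * inner ℝ (∇ w y) (X y)
        - inner ℝ (∇ w y) (fderiv ℝ (∇ w) y (X y)) := by
      have h1 : HasFDerivAt R _ y := ((hP (w y)).comp_hasFDerivAt y hwy.hasFDerivAt).sub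
        (hgy.hasFDerivAt.norm_sq.const_mul (1 / 2))
      rw [h1.fderiv, inner_gradient_left (f := w) (x := y)]
      simp
    have hSy : S y = (α + b) * ‖∇ w y‖ ^ 2 - α * (N (w y) * w y)
      + (-2 * κ * inner ℝ (y - x₀) (X y) + b * Module.finrank ℝ E) * R y := rfl
    have hmy : m y = α * w y + inner ℝ (∇ w y) (X y) := rfl
    have hXy : b • (y - x₀) + v = X y := rfl
    simp only [hT]
    rw [hXy, fderiv_mul_apply hχy (hm1.differentiable one_ne_zero y),
      fderiv_mul_apply hχy ((hG1.differentiable one_ne_zero y).fun_mul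
        (hR1.differentiable one_ne_zero y)),
      fderiv_mul_apply (hG1.differentiable one_ne_zero y) (hR1.differentiable one_ne_zero y),
      fderiv_gauss_apply, hmd, hRd, hSy, hmy]
    ring
  -- As the cutoff is removed, the terms with ∇χ tend to 0 and χS tends to S; the majorant is at
  -- most quadratic in ∇w, hence integrable by the Caccioppoli estimate.
  have hlim : Tendsto (fun k => ∫ y, T k y) atTop (𝓝 (∫ y, S y * gauss x₀ κ y)) := by
    refine tendsto_integral_of_dominated_convergence
      (fun y => (C * (‖∇ w y‖ * |m y|) + C * (‖X y‖ * |R y|) + |S y|) * gauss x₀ κ y)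
      (fun k => ?_) ?_ (fun k => ae_of_all _ fun y => ?_) (ae_of_all _ fun y => ?_)
    · have hχkd := ((hχ k).of_le (m := 1) (by simp)).continuous_fderiv one_ne_zero
      have hχkc := (hχ k).continuous
      have hmc := hm1.continuous
      exact Continuous.aestronglyMeasurable (by fun_prop)
    · refine (GaussInt.add ((hmG.const_mul C).add (hXG.const_mul C)) (hSG.of_le hSc.abs 1
        fun y => ?_)).integrable κ hκ
      rw [abs_abs, one_mul]
      exact le_mul_of_one_le_left (abs_nonneg _) (by linarith [sq_nonneg ‖y - x₀‖])
    · have hCk : C / (k + 1) ≤ C := div_le_self hC0 (by linarith [Nat.cast_nonneg (α := ℝ) k])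
      have hle (u : E) : |fderiv ℝ (χ k) y u| ≤ C * ‖u‖ := (hχd k y u).trans (by gcongr)
      rw [hT, Real.norm_eq_abs, abs_mul, abs_of_pos (gauss_pos _ _ _)]
      refine mul_le_mul_of_nonneg_right ?_ (gauss_pos _ _ _).le
      refine (abs_add_le _ _).trans (add_le_add ((abs_add_le _ _).trans (add_le_add ?_ ?_)) ?_)
      · rw [abs_mul, ← mul_assoc]
        gcongr
        exact hle _
      · rw [abs_mul, ← mul_assoc]
        gcongr
        exact hle _
      · rw [abs_mul, abs_of_nonneg (hχ0 k y)]
        exact mul_le_of_le_one_left (abs_nonneg _) (hχ1 k y)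
    · have hd (u : E) : Tendsto (fun k => fderiv ℝ (χ k) y u) atTop (𝓝 0) := by
        refine squeeze_zero_norm (hχd · y u) ?_
        have h1 : Tendsto (fun k : ℕ => C / ((k : ℝ) + 1)) atTop (𝓝 0) :=
          tendsto_const_nhds.div_atTop
            (tendsto_atTop_add_const_right _ _ tendsto_natCast_atTop_atTop)
        simpa using h1.mul_const ‖u‖
      simpa using ((((hd (∇ w y)).mul_const (m y)).add ((hd (X y)).mul_const (R y))).add
        ((tendsto_cutoff hχe y).mul_const (S y))).mul_const (gauss x₀ κ y)
  simp only [hzero] at hlim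
  exact ⟨hSG.integrable κ hκ, tendsto_nhds_unique hlim tendsto_const_nhds⟩

end Pohozaev

/-! ### Differentiating Gaussian integrals in centre and time -/

section ParametricIntegral

variable {n : ℕ}

local notation "𝔼" => EuclideanSpace ℝ (Fin n)

theorem G_eq_gauss (x₀ y : 𝔼) (t₀ : ℝ) :
    G (y - x₀) t₀ = (-(4 * Real.pi * t₀)) ^ (-(n : ℝ) / 2) * gauss x₀ (-(1 / (4 * t₀))) y := by
  rw [G, gauss, neg_neg, one_div, mul_comm (4 * t₀)⁻¹, ← div_eq_mul_inv (‖y - x₀‖ ^ 2)]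

theorem G_nonneg (y : 𝔼) {t : ℝ} (ht : t < 0) : 0 ≤ G y t :=
  mul_nonneg (Real.rpow_nonneg (by nlinarith [Real.pi_pos]) _) (Real.exp_pos _).le

theorem continuous_G (x : 𝔼) (t : ℝ) : Continuous (fun y : 𝔼 => G (y - x) t) := by
  unfold G
  fun_prop

/-- The logarithmic derivative of `(x, t) ↦ G (y - x) t`. -/
def logDerivG (y x : 𝔼) (t : ℝ) : 𝔼 × ℝ →L[ℝ] ℝ :=
  (-(1 / (2 * t))) • (innerSL ℝ (y - x)).comp (ContinuousLinearMap.fst ℝ 𝔼 ℝ)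
    + (-(n / (2 * t)) - ‖y - x‖ ^ 2 / (4 * t ^ 2)) • ContinuousLinearMap.snd ℝ 𝔼 ℝ

theorem logDerivG_apply (y x v : 𝔼) (t τ : ℝ) : logDerivG y x t (v, τ) =
    -(1 / (2 * t)) * inner ℝ (y - x) v + (-(n / (2 * t)) - ‖y - x‖ ^ 2 / (4 * t ^ 2)) * τ := by
  rw [logDerivG, add_apply, smul_apply, smul_apply, ContinuousLinearMap.comp_apply,
    innerSL_apply_apply, smul_eq_mul, smul_eq_mul]
  rfl

theorem continuous_logDerivG (x : 𝔼) (t : ℝ) : Continuous (fun y : 𝔼 => logDerivG y x t) := by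
  unfold logDerivG
  have h : Continuous (fun y : 𝔼 => (innerSL ℝ (y - x)).comp (ContinuousLinearMap.fst ℝ 𝔼 ℝ)) :=
    ((innerSL ℝ).continuous.comp (continuous_id.sub continuous_const)).clm_comp continuous_const
  fun_prop

theorem hasFDerivAt_G (y x : 𝔼) {t : ℝ} (ht : t < 0) :
    HasFDerivAt (fun q : 𝔼 × ℝ => G (y - q.1) q.2) (G (y - x) t • logDerivG y x t) (x, t) := by
  have hpos : 0 < -(4 * Real.pi * t) := by nlinarith [Real.pi_pos]
  have h2 : HasFDerivAt (fun q : 𝔼 × ℝ => q.2) (ContinuousLinearMap.snd ℝ 𝔼 ℝ) (x, t) :=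
    hasFDerivAt_snd
  have h1 : HasFDerivAt (fun q : 𝔼 × ℝ => y - q.1) (-ContinuousLinearMap.fst ℝ 𝔼 ℝ) (x, t) :=
    hasFDerivAt_fst.const_sub y
  have hA := ((h2.const_mul (4 * Real.pi)).fun_neg).rpow_const (p := -(n : ℝ) / 2) (Or.inl hpos.ne')
  have hB := (h1.norm_sq.fun_mul ((hasDerivAt_inv (x := 4 * t) (by linarith)).comp_hasFDerivAt (x, t)
    (h2.const_mul 4))).exp
  have hC := hA.fun_mul hB
  have hfun : (fun q : 𝔼 × ℝ => G (y - q.1) q.2) = fun q : 𝔼 × ℝ =>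
      (-(4 * Real.pi * q.2)) ^ (-(n : ℝ) / 2) * Real.exp (‖y - q.1‖ ^ 2 * (4 * q.2)⁻¹) := by
    ext q
    rw [G, div_eq_mul_inv (‖y - q.1‖ ^ 2)]
  rw [hfun]
  refine hC.congr_fderiv ?_
  refine ContinuousLinearMap.ext fun ⟨v, τ⟩ => ?_
  have hpow : (-(4 * Real.pi * t)) ^ (-(n : ℝ) / 2 - 1)
      = (-(4 * Real.pi * t)) ^ (-(n : ℝ) / 2) / (-(4 * Real.pi * t)) :=
    Real.rpow_sub_one hpos.ne' _
  have ht0 : t ≠ 0 := ht.ne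
  rw [smul_apply, logDerivG_apply, inner_sub_left, G, div_eq_mul_inv (‖y - x‖ ^ 2) (4 * t)]
  simp [hpow]
  field_simp
  ring

theorem norm_logDerivG_le (y x : 𝔼) (t : ℝ) :
    ‖logDerivG y x t‖ ≤ |1 / (2 * t)| * ‖y - x‖ + (|n / (2 * t)| + ‖y - x‖ ^ 2 / (4 * t ^ 2)) := by
  unfold logDerivG
  refine (norm_add_le _ _).trans (add_le_add ?_ ?_)
  · rw [norm_smul, norm_neg, Real.norm_eq_abs]
    gcongr
    refine (ContinuousLinearMap.opNorm_comp_le _ _).trans ?_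
    rw [innerSL_apply_norm]
    exact mul_le_of_le_one_right (norm_nonneg _) (ContinuousLinearMap.norm_fst_le ℝ 𝔼 ℝ)
  · rw [norm_smul]
    refine (mul_le_of_le_one_right (norm_nonneg _)
      (ContinuousLinearMap.norm_snd_le ℝ 𝔼 ℝ)).trans ?_
    rw [Real.norm_eq_abs]
    refine (abs_sub _ _).trans ?_
    rw [abs_neg, abs_of_nonneg (a := ‖y - x‖ ^ 2 / (4 * t ^ 2)) (by positivity)]

/-- Locally uniform Gaussian bounds for `G (y - x) t` and its first derivatives. -/
theorem exists_G_bound (x₀ : 𝔼) {t₀ : ℝ} (ht₀ : t₀ < 0) : ∃ δ > 0, δ ≤ 1 ∧ ∃ ε > 0, ∃ C, 0 ≤ C ∧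
    ∀ (x : 𝔼) (t : ℝ), ‖x - x₀‖ < δ → |t - t₀| < δ → t < 0 ∧
      ∀ y, G (y - x) t ≤ C * gauss x₀ ε y ∧
        ‖logDerivG y x t‖ ≤ C * (1 + ‖y - x₀‖ ^ 2) := by
  obtain ⟨a, ha, rfl⟩ : ∃ a > 0, t₀ = -a := ⟨-t₀, by linarith, by simp⟩
  -- For b = -t within a/2 of a one has a/2 ≤ b ≤ 3a/2, so 1/(4b) ≥ 1/(6a) and 4πb ≥ 2πa. With |y -
  -- x|² ≥ |y - x₀|²/2 - 1 this yields the rate 1/(12a) and the factor e^{1/(6a)}. C₂ collects the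
  -- bounds for the coefficients of the logarithmic derivative.
  set C₁ := (2 * Real.pi * a) ^ (-(n : ℝ) / 2) * Real.exp (1 / (6 * a))
  set C₂ := 3 / a + n / a + 2 / a ^ 2
  have hC₁ : 0 ≤ C₁ := by positivity
  have hC₂ : 0 ≤ C₂ := by positivity
  refine ⟨min 1 (a / 2), by positivity, min_le_left _ _, 1 / (12 * a), by positivity, C₁ + C₂,
    by positivity, fun x t hx ht => ?_⟩
  have hx1 : ‖x - x₀‖ ≤ 1 := (hx.trans_le (min_le_left _ _)).le
  have ht1 := abs_lt.1 (ht.trans_le (min_le_right _ _))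
  have ht0 : t < 0 := by linarith [ht1.2]
  obtain ⟨b, rfl⟩ : ∃ b, t = -b := ⟨-t, by simp⟩
  have hb1 : a / 2 ≤ b := by linarith [ht1.2]
  have hb2 : b ≤ 3 * a / 2 := by linarith [ht1.1]
  have hb0 : 0 < b := by linarith
  refine ⟨ht0, fun y => ?_⟩
  have hz1 : ‖y - x‖ ≤ ‖y - x₀‖ + 1 := by
    have : y - x = (y - x₀) - (x - x₀) := by abel
    rw [this]
    exact (norm_sub_le _ _).trans (by gcongr)
  have hz2 : ‖y - x₀‖ ≤ ‖y - x‖ + 1 := by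
    have : y - x₀ = (y - x) + (x - x₀) := by abel
    rw [this]
    exact (norm_add_le _ _).trans (by gcongr)
  have hr0 := norm_nonneg (y - x)
  have hr1 := norm_nonneg (y - x₀)
  set r := ‖y - x‖
  set r₀ := ‖y - x₀‖
  have hrr : r ^ 2 ≤ 2 * r₀ ^ 2 + 2 := by nlinarith [sq_nonneg (r₀ - 1)]
  have hrr' : r₀ ^ 2 / 2 - 1 ≤ r ^ 2 := by nlinarith [sq_nonneg (r - 1)]
  have hgp := gauss_pos x₀ (1 / (12 * a)) y
  constructor
  · have hle : G (y - x) (-b) ≤ C₁ * gauss x₀ (1 / (12 * a)) y := by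
      have e1 : (-(4 * Real.pi * -b)) ^ (-(n : ℝ) / 2) ≤ (2 * Real.pi * a) ^ (-(n : ℝ) / 2) := by
        refine Real.rpow_le_rpow_of_nonpos (by positivity) ?_ ?_
        · nlinarith [Real.pi_pos]
        · rw [neg_div]
          exact neg_nonpos.2 (by positivity)
      have e2 : r ^ 2 / (4 * -b) ≤ 1 / (6 * a) + -(1 / (12 * a)) * r₀ ^ 2 := by
        have e3 : (r₀ ^ 2 / 2 - 1) / (6 * a) ≤ r ^ 2 / (4 * b) := by
          calc (r₀ ^ 2 / 2 - 1) / (6 * a) ≤ r ^ 2 / (6 * a) := by gcongr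
            _ ≤ r ^ 2 / (4 * b) := by
              apply div_le_div_of_nonneg_left (by positivity) (by positivity)
              linarith
        have e4 : r ^ 2 / (4 * -b) = -(r ^ 2 / (4 * b)) := by rw [mul_neg, div_neg]
        have e5 : (r₀ ^ 2 / 2 - 1) / (6 * a) = -(1 / (6 * a)) + 1 / (12 * a) * r₀ ^ 2 := by
          field_simp
          ring
        rw [e4]
        linarith
      calc G (y - x) (-b) ≤ (2 * Real.pi * a) ^ (-(n : ℝ) / 2)
            * Real.exp (1 / (6 * a) + -(1 / (12 * a)) * r₀ ^ 2) := by
            unfold G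
            gcongr
        _ = _ := by
            rw [Real.exp_add, ← mul_assoc, gauss]
    refine hle.trans ?_
    gcongr
    linarith
  · refine (norm_logDerivG_le y x (-b)).trans ?_
    have e1 : |1 / (2 * -b)| ≤ 1 / a := by
      rw [mul_neg, div_neg, abs_neg, abs_of_nonneg (by positivity)]
      gcongr
      linarith
    have e2 : |(n : ℝ) / (2 * -b)| ≤ n / a := by
      rw [mul_neg, div_neg, abs_neg, abs_of_nonneg (by positivity)]
      gcongr
      linarith
    have e3 : r ^ 2 / (4 * (-b) ^ 2) ≤ (2 * r₀ ^ 2 + 2) / a ^ 2 := by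
      gcongr
      nlinarith
    have e4 : r ≤ 3 + 3 * r₀ ^ 2 := by nlinarith [sq_nonneg (r - 1)]
    calc |1 / (2 * -b)| * r + (|(n : ℝ) / (2 * -b)| + r ^ 2 / (4 * (-b) ^ 2))
        ≤ 1 / a * (3 + 3 * r₀ ^ 2) + (n / a + (2 * r₀ ^ 2 + 2) / a ^ 2) := by gcongr
      _ ≤ C₂ * (1 + r₀ ^ 2) := by
        have : 0 ≤ n / a * r₀ ^ 2 := by positivity
        have e5 : C₂ * (1 + r₀ ^ 2) = 1 / a * (3 + 3 * r₀ ^ 2) + (n / a + (2 * r₀ ^ 2 + 2) / a ^ 2)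
          + n / a * r₀ ^ 2 := by
          simp only [C₂]
          ring
        linarith
      _ ≤ (C₁ + C₂) * (1 + r₀ ^ 2) := by
        gcongr
        linarith

/-- Differentiation of `∫ H(s, y) G(y - x(s), t(s)) dy` at `s = 0`. -/
theorem hasDerivAt_integral_mul_G {x₀ : 𝔼} {t₀ : ℝ} (ht₀ : t₀ < 0) {H H' : ℝ → 𝔼 → ℝ} {B : 𝔼 → ℝ}
    (hB : GaussInt x₀ B) (hHc : ∀ s, Continuous (H s)) (hHc' : Continuous (H' 0))
    (hd : ∀ s y, HasDerivAt (fun s => H s y) (H' s y) s)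
    (hHB : ∀ s y, |s| < 1 → |H s y| ≤ B y) (hHB' : ∀ s y, |s| < 1 → |H' s y| ≤ B y)
    {x : ℝ → 𝔼} {t : ℝ → ℝ} {v : 𝔼} {τ : ℝ} (hx0 : x 0 = x₀) (ht0 : t 0 = t₀)
    (hx : HasDerivAt x v 0) (ht : HasDerivAt t τ 0) :
    (∀ᶠ s in 𝓝 (0 : ℝ), Integrable (fun y => H s y * G (y - x s) (t s))) ∧
    Integrable (fun y => (H' 0 y + H 0 y * logDerivG y x₀ t₀ (v, τ)) * G (y - x₀) t₀) ∧
    HasDerivAt (fun s => ∫ y, H s y * G (y - x s) (t s))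
      (∫ y, (H' 0 y + H 0 y * logDerivG y x₀ t₀ (v, τ)) * G (y - x₀) t₀) 0 := by
  obtain ⟨δ, hδ, hδ1, ε, hε, C, hC, hbd⟩ := exists_G_bound x₀ ht₀
  have hB0 (y) : 0 ≤ B y := (abs_nonneg _).trans (hHB 0 y (by simp))
  -- The curves are differentiable only at s = 0, whereas dominated differentiation needs
  -- derivatives in a neighbourhood. So s, x and t are treated as independent parameters, and the
  -- curve enters at the end through the chain rule.
  set p₀ : ℝ × (𝔼 × ℝ) := (0, x₀, t₀) with hp₀
  have hball (q : ℝ × (𝔼 × ℝ)) (hq : q ∈ Metric.ball p₀ δ) :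
      |q.1| < 1 ∧ ‖q.2.1 - x₀‖ < δ ∧ |q.2.2 - t₀| < δ := by
    rw [mem_ball_iff_norm, Prod.norm_def, Prod.norm_def, max_lt_iff, max_lt_iff] at hq
    simp only [Prod.fst_sub, Prod.snd_sub, hp₀, sub_zero, Real.norm_eq_abs] at hq
    exact ⟨hq.1.trans_le hδ1, hq.2⟩
  set Φ : ℝ × (𝔼 × ℝ) → 𝔼 → ℝ := fun q y => H q.1 y * G (y - q.2.1) q.2.2 with hΦ
  set Φ' : ℝ × (𝔼 × ℝ) → 𝔼 → (ℝ × (𝔼 × ℝ) →L[ℝ] ℝ) := fun q y =>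
    H q.1 y • ((G (y - q.2.1) q.2.2 • logDerivG y q.2.1 q.2.2).comp
      (ContinuousLinearMap.snd ℝ ℝ (𝔼 × ℝ)))
    + G (y - q.2.1) q.2.2 • (H' q.1 y • ContinuousLinearMap.fst ℝ ℝ (𝔼 × ℝ)) with hΦ'
  have hΦc (q) : Continuous (Φ q) := (hHc _).mul (continuous_G _ _)
  have hΦi (q) (hq : q ∈ Metric.ball p₀ δ) : Integrable (Φ q) := by
    obtain ⟨h1, h2, h3⟩ := hball q hq
    obtain ⟨htn, hb⟩ := hbd q.2.1 q.2.2 h2 h3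
    refine ((hB.integrable ε hε).const_mul C).mono' (hΦc q).aestronglyMeasurable
      (ae_of_all _ fun y => ?_)
    rw [Real.norm_eq_abs, abs_mul, abs_of_nonneg (G_nonneg _ htn)]
    calc |H q.1 y| * G (y - q.2.1) q.2.2 ≤ B y * (C * gauss x₀ ε y) := by
          gcongr
          · exact G_nonneg _ htn
          · exact hB0 y
          · exact hHB _ _ h1
          · exact (hb y).1
      _ = _ := by ring
  -- C comes from differentiating H (one bound on G), C² from differentiating G (bounds on G and on
  -- its logarithmic derivative).
  have hdom : Integrable (fun y => (C + C ^ 2) * ((1 + ‖y - x₀‖ ^ 2) * B y) * gauss x₀ ε y) :=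
    ((hB.mul_le (g := fun y => 1 + ‖y - x₀‖ ^ 2) (by fun_prop) 1 fun y => by
      rw [abs_of_nonneg (by positivity), one_mul]).const_mul _).integrable ε hε
  have hΦ'b (y) (q) (hq : q ∈ Metric.ball p₀ δ) :
      ‖Φ' q y‖ ≤ (C + C ^ 2) * ((1 + ‖y - x₀‖ ^ 2) * B y) * gauss x₀ ε y := by
    obtain ⟨h1, h2, h3⟩ := hball q hq
    obtain ⟨htn, hb⟩ := hbd q.2.1 q.2.2 h2 h3
    have hG0 := G_nonneg (y - q.2.1) htn
    have hg0 := gauss_pos x₀ ε y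
    have e1 : ‖(G (y - q.2.1) q.2.2 • logDerivG y q.2.1 q.2.2).comp
        (ContinuousLinearMap.snd ℝ ℝ (𝔼 × ℝ))‖
        ≤ C * gauss x₀ ε y * (C * (1 + ‖y - x₀‖ ^ 2)) := by
      refine (ContinuousLinearMap.opNorm_comp_le _ _).trans ((mul_le_of_le_one_right
        (norm_nonneg _) (ContinuousLinearMap.norm_snd_le _ _ _)).trans ?_)
      rw [norm_smul, Real.norm_of_nonneg hG0]
      exact mul_le_mul (hb y).1 (hb y).2 (norm_nonneg _) (by positivity)
    have e2 : ‖H' q.1 y • ContinuousLinearMap.fst ℝ ℝ (𝔼 × ℝ)‖ ≤ B y := by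
      rw [norm_smul]
      exact (mul_le_of_le_one_right (norm_nonneg _) (ContinuousLinearMap.norm_fst_le _ _ _)).trans
        (hHB' _ _ h1)
    calc ‖Φ' q y‖ ≤ |H q.1 y| * (C * gauss x₀ ε y * (C * (1 + ‖y - x₀‖ ^ 2)))
          + G (y - q.2.1) q.2.2 * B y := by
          refine (norm_add_le _ _).trans ?_
          rw [norm_smul, norm_smul, Real.norm_of_nonneg hG0, Real.norm_eq_abs]
          gcongr
      _ ≤ B y * (C * gauss x₀ ε y * (C * (1 + ‖y - x₀‖ ^ 2))) + C * gauss x₀ ε y * B y := by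
          gcongr
          · exact hHB _ _ h1
          · exact hB0 y
          · exact (hb y).1
      _ ≤ _ := by
          have : 0 ≤ C * gauss x₀ ε y * B y * ‖y - x₀‖ ^ 2 := by
            have := hB0 y
            positivity
          nlinarith
  have hΦ'c : Continuous (Φ' p₀) := by
    have h1 := hHc 0
    have h2 := continuous_G x₀ t₀
    have h3 := continuous_logDerivG x₀ t₀
    exact (h1.smul ((h2.smul h3).clm_comp continuous_const)).add
      (h2.smul (hHc'.smul continuous_const))
  have hderiv := hasFDerivAt_integral_of_dominated_of_fderiv_le (μ := (volume : Measure 𝔼))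
    (F := Φ) (F' := Φ') (x₀ := p₀) (Metric.ball_mem_nhds p₀ hδ)
    (Eventually.of_forall fun q => (hΦc q).aestronglyMeasurable)
    (hΦi p₀ (Metric.mem_ball_self hδ)) hΦ'c.aestronglyMeasurable
    (ae_of_all _ hΦ'b) hdom
    (ae_of_all _ fun y q hq => by
      obtain ⟨h1, h2, h3⟩ := hball q hq
      obtain ⟨htn, -⟩ := hbd q.2.1 q.2.2 h2 h3
      have e1 : HasFDerivAt (fun q : ℝ × (𝔼 × ℝ) => H q.1 y) _ q :=
        (hd q.1 y).comp_hasFDerivAt q (ContinuousLinearMap.fst ℝ ℝ (𝔼 × ℝ)).hasFDerivAt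
      have e2 : HasFDerivAt (fun q : ℝ × (𝔼 × ℝ) => G (y - q.2.1) q.2.2) _ q :=
        HasFDerivAt.comp (f := fun q : ℝ × (𝔼 × ℝ) => q.2) q (hasFDerivAt_G y q.2.1 htn)
          (ContinuousLinearMap.snd ℝ ℝ (𝔼 × ℝ)).hasFDerivAt
      exact e1.mul e2)
  have hΦ'i : Integrable (Φ' p₀) :=
    hdom.mono' hΦ'c.aestronglyMeasurable
      (ae_of_all _ fun y => hΦ'b y p₀ (Metric.mem_ball_self hδ))
  have hval (y) : Φ' p₀ y (1, v, τ)
      = (H' 0 y + H 0 y * logDerivG y x₀ t₀ (v, τ)) * G (y - x₀) t₀ := by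
    simp [hΦ', hp₀]
    ring
  have hcurve : HasDerivAt (fun s => ((s, x s, t s) : ℝ × (𝔼 × ℝ))) (1, v, τ) 0 :=
    (hasDerivAt_id (0 : ℝ)).prodMk (hx.prodMk ht)
  have hc0 : ((0, x 0, t 0) : ℝ × (𝔼 × ℝ)) = p₀ := by rw [hx0, ht0]
  refine ⟨?_, ?_, ?_⟩
  · have := hcurve.continuousAt.tendsto
    rw [hc0] at this
    filter_upwards [this (Metric.ball_mem_nhds p₀ hδ)] with s hs
    exact hΦi _ hs
  · simpa only [hval] using hΦ'i.apply_continuousLinearMap (1, v, τ)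
  · have h := HasFDerivAt.comp_hasDerivAt (0 : ℝ) (f := fun s => ((s, x s, t s) : ℝ × (𝔼 × ℝ)))
      (by rw [hc0]; exact hderiv) hcurve
    rw [ContinuousLinearMap.integral_apply hΦ'i] at h
    simp only [hval] at h
    exact h

end ParametricIntegral

/-! ### First variation of the three integrals -/

section FirstVariation

variable {n : ℕ}

local notation "𝔼" => EuclideanSpace ℝ (Fin n)

theorem hasDerivAt_abs_rpow_add_one {p : ℝ} (hp : 1 < p) (x : ℝ) :
    HasDerivAt (fun x : ℝ => |x| ^ (p + 1)) ((p + 1) * (|x| ^ (p - 1) * x)) x := by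
  convert hasDerivAt_abs_rpow x (p := p + 1) (by linarith) using 1
  rw [show p + 1 - 2 = p - 1 by ring, mul_assoc]

theorem abs_rpow_add_one {p : ℝ} (hp : 1 < p) (x : ℝ) :
    |x| ^ (p + 1) = |x| ^ (p - 1) * x ^ 2 := by
  have h : |x| ^ (p + 1) = |x| ^ (p - 1) * |x| ^ (2 : ℝ) := by
    rw [← Real.rpow_add_of_nonneg (abs_nonneg x) (by linarith) (by norm_num)]
    ring_nf
  rw [h, Real.rpow_two, sq_abs]

/-- The zeroth order term `w / ((p - 1) t₀) + |w|^{p-1} w` of the profile equation. -/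
def reaction (p t₀ x : ℝ) : ℝ := 1 / ((p - 1) * t₀) * x + |x| ^ (p - 1) * x

/-- A primitive of `reaction`. -/
def reactionPotential (p t₀ x : ℝ) : ℝ :=
  1 / ((p - 1) * t₀) * (1 / 2 * x ^ 2) + 1 / (p + 1) * |x| ^ (p + 1)

theorem continuous_reaction {p : ℝ} (hp : 1 < p) (t₀ : ℝ) : Continuous (reaction p t₀) := by
  unfold reaction
  have : Continuous (fun x : ℝ => |x| ^ (p - 1)) :=
    continuous_abs.rpow_const fun _ => Or.inr (by linarith)
  fun_prop

theorem hasDerivAt_reactionPotential {p : ℝ} (hp : 1 < p) (t₀ x : ℝ) :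
    HasDerivAt (reactionPotential p t₀) (reaction p t₀ x) x := by
  have h := (((hasDerivAt_pow 2 x).const_mul (1 / 2)).const_mul (1 / ((p - 1) * t₀))).add
    ((hasDerivAt_abs_rpow_add_one hp x).const_mul (1 / (p + 1)))
  refine h.congr_deriv ?_
  have hp1 : p + 1 ≠ 0 := by linarith
  rw [← mul_assoc (1 / (p + 1)), one_div_mul_cancel hp1, one_mul, reaction]
  norm_num
  exact Or.inl (by ring)

/-- Here κ = -1/(4t₀) is exactly the rate of the Gaussian at time t₀, so the drift matches the
weight. -/
theorem solvesProfileEquation_iff (p : ℝ) (x₀ : 𝔼) (t₀ : ℝ) (w : 𝔼 → ℝ) :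
    SolvesProfileEquation p x₀ t₀ w ↔
      ∀ y, Δ w y - 2 * -(1 / (4 * t₀)) * inner ℝ (y - x₀) (∇ w y) + reaction p t₀ (w y) = 0 := by
  refine forall_congr' fun y => ?_
  rw [inner_smul_left, reaction]
  have h : Δ w y - 2 * -(1 / (4 * t₀)) * inner ℝ (y - x₀) (∇ w y)
      = Δ w y + (starRingEnd ℝ) (1 / (2 * t₀)) * inner ℝ (y - x₀) (∇ w y) := by
    simp only [conj_trivial]
    ring
  rw [h, ← add_assoc]

theorem gradient_add_mul {w φ : 𝔼 → ℝ} (hw : ContDiff ℝ ∞ w) (hφ : ContDiff ℝ ∞ φ) (s : ℝ) (y : 𝔼) :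
    ∇ (fun y => w y + s * φ y) y = ∇ w y + s • ∇ φ y := by
  have h1 := (hw.differentiable (by simp) y).hasGradientAt.hasFDerivAt
  have h2 := (hφ.differentiable (by simp) y).hasGradientAt.hasFDerivAt
  have h3 := h1.fun_add (h2.const_mul s)
  refine HasGradientAt.gradient ?_
  rw [hasGradientAt_iff_hasFDerivAt]
  refine h3.congr_fderiv ?_
  simp

theorem norm_gradient_add_mul_sq {w φ : 𝔼 → ℝ} (hw : ContDiff ℝ ∞ w) (hφ : ContDiff ℝ ∞ φ)
    (s : ℝ) (y : 𝔼) : ‖∇ (fun y => w y + s * φ y) y‖ ^ 2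
      = ‖∇ w y‖ ^ 2 + s * (2 * inner ℝ (∇ w y) (∇ φ y)) + s ^ 2 * ‖∇ φ y‖ ^ 2 := by
  rw [gradient_add_mul hw hφ, norm_add_sq_real, inner_smul_right, norm_smul, mul_pow,
    Real.norm_eq_abs, sq_abs]
  ring

theorem hasCompactSupport_gradient {φ : 𝔼 → ℝ} (hφ : HasCompactSupport φ) :
    HasCompactSupport (∇ φ) :=
  (hφ.fderiv (𝕜 := ℝ)).comp_left (g := (InnerProductSpace.toDual ℝ 𝔼).symm) (map_zero _)

section Curves

variable {p t₀ τ : ℝ} {x₀ v : EuclideanSpace ℝ (Fin n)} {w φ : EuclideanSpace ℝ (Fin n) → ℝ}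
  {x : ℝ → EuclideanSpace ℝ (Fin n)} {t : ℝ → ℝ}

/-- The time of the Gaussian varies, so integrability of |∇w|² against the single Gaussian at t₀
would not do; hence the hypothesis `hq` for all rates. -/
theorem hasDerivAt_gradient_integral (ht₀ : t₀ < 0) (hw : ContDiff ℝ ∞ w)
    (hq : GaussInt x₀ (fun y => ‖∇ w y‖ ^ 2)) (hφ : ContDiff ℝ ∞ φ) (hφc : HasCompactSupport φ)
    (hx0 : x 0 = x₀) (ht0 : t 0 = t₀) (hx : HasDerivAt x v 0) (ht : HasDerivAt t τ 0) :
    (∀ᶠ s in 𝓝 (0 : ℝ),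
      Integrable (fun y => ‖∇ (fun y => w y + s * φ y) y‖ ^ 2 * G (y - x s) (t s))) ∧
    Integrable (fun y => (2 * inner ℝ (∇ w y) (∇ φ y)
      + ‖∇ w y‖ ^ 2 * logDerivG y x₀ t₀ (v, τ)) * G (y - x₀) t₀) ∧
    HasDerivAt (fun s => ∫ y, ‖∇ (fun y => w y + s * φ y) y‖ ^ 2 * G (y - x s) (t s))
      (∫ y, (2 * inner ℝ (∇ w y) (∇ φ y)
        + ‖∇ w y‖ ^ 2 * logDerivG y x₀ t₀ (v, τ)) * G (y - x₀) t₀) 0 := by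
  have hgw := continuous_gradient hw
  have hgφ := continuous_gradient hφ
  obtain ⟨C, hC⟩ := (hasCompactSupport_gradient hφc).exists_bound_of_continuous hgφ
  have hC2 (y) : ‖∇ φ y‖ ^ 2 ≤ C ^ 2 := by
    gcongr
    exact hC y
  have hin (y) : |2 * inner ℝ (∇ w y) (∇ φ y)| ≤ ‖∇ w y‖ ^ 2 + ‖∇ φ y‖ ^ 2 := by
    rw [abs_mul, abs_two]
    have := abs_real_inner_le_norm (∇ w y) (∇ φ y)
    nlinarith [sq_nonneg (‖∇ w y‖ - ‖∇ φ y‖)]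
  simp_rw [norm_gradient_add_mul_sq hw hφ]
  have h := hasDerivAt_integral_mul_G ht₀
    (H := fun s y => ‖∇ w y‖ ^ 2 + s * (2 * inner ℝ (∇ w y) (∇ φ y)) + s ^ 2 * ‖∇ φ y‖ ^ 2)
    (H' := fun s y => 2 * inner ℝ (∇ w y) (∇ φ y) + 2 * s * ‖∇ φ y‖ ^ 2)
    -- For |s| < 1, 2|∇w·∇φ| ≤ |∇w|² + |∇φ|² bounds H by 2|∇w|² + 2C² and H' by |∇w|² + 3C².
    (B := fun y => 2 * ‖∇ w y‖ ^ 2 + 3 * C ^ 2) ((hq.const_mul 2).add (GaussInt.const x₀ _))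
    (fun s => by fun_prop) (by fun_prop)
    (fun s y => by
      have h1 := (((hasDerivAt_id s).mul_const (2 * inner ℝ (∇ w y) (∇ φ y))).const_add
        (‖∇ w y‖ ^ 2)).add ((hasDerivAt_pow 2 s).mul_const (‖∇ φ y‖ ^ 2))
      refine h1.congr_deriv ?_
      simp)
    (fun s y hs => by
      have hs2 : s ^ 2 ≤ 1 := by nlinarith [abs_lt.1 hs, sq_abs s, abs_nonneg s]
      have e1 : |s * (2 * inner ℝ (∇ w y) (∇ φ y))| ≤ 1 * (‖∇ w y‖ ^ 2 + ‖∇ φ y‖ ^ 2) := by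
        rw [abs_mul]
        exact mul_le_mul hs.le (hin y) (abs_nonneg _) zero_le_one
      have e2 : s ^ 2 * ‖∇ φ y‖ ^ 2 ≤ 1 * ‖∇ φ y‖ ^ 2 := by gcongr
      refine (abs_add_le _ _).trans ?_
      rw [abs_of_nonneg (a := s ^ 2 * ‖∇ φ y‖ ^ 2) (by positivity)]
      have e3 := abs_add_le (‖∇ w y‖ ^ 2) (s * (2 * inner ℝ (∇ w y) (∇ φ y)))
      rw [abs_of_nonneg (a := ‖∇ w y‖ ^ 2) (by positivity)] at e3
      nlinarith [hC2 y])
    (fun s y hs => by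
      refine (abs_add_le _ _).trans ?_
      have e1 : |2 * s * ‖∇ φ y‖ ^ 2| ≤ 2 * 1 * ‖∇ φ y‖ ^ 2 := by
        rw [abs_mul, abs_mul, abs_two, abs_of_nonneg (a := ‖∇ φ y‖ ^ 2) (by positivity)]
        gcongr
      nlinarith [hC2 y, hin y, sq_nonneg ‖∇ w y‖])
    hx0 ht0 hx ht
  simpa using h

theorem hasDerivAt_power_integral (ht₀ : t₀ < 0) (hp : 1 < p) (hw : Continuous w)
    (hbdd : ∃ M : ℝ, ∀ y, |w y| ≤ M) (hφ : Continuous φ) (hφc : HasCompactSupport φ)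
    (hx0 : x 0 = x₀) (ht0 : t 0 = t₀) (hx : HasDerivAt x v 0) (ht : HasDerivAt t τ 0) :
    (∀ᶠ s in 𝓝 (0 : ℝ), Integrable (fun y => |w y + s * φ y| ^ (p + 1) * G (y - x s) (t s))) ∧
    Integrable (fun y => ((p + 1) * (|w y| ^ (p - 1) * w y) * φ y
      + |w y| ^ (p + 1) * logDerivG y x₀ t₀ (v, τ)) * G (y - x₀) t₀) ∧
    HasDerivAt (fun s => ∫ y, |w y + s * φ y| ^ (p + 1) * G (y - x s) (t s))
      (∫ y, ((p + 1) * (|w y| ^ (p - 1) * w y) * φ y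
        + |w y| ^ (p + 1) * logDerivG y x₀ t₀ (v, τ)) * G (y - x₀) t₀) 0 := by
  obtain ⟨M, hM⟩ := hbdd
  obtain ⟨K, hK⟩ := hφc.exists_bound_of_continuous hφ
  have hM0 : 0 ≤ M := (abs_nonneg _).trans (hM 0)
  have hK0 : 0 ≤ K := (norm_nonneg _).trans (hK 0)
  have hc1 : Continuous (fun x : ℝ => |x| ^ (p + 1)) :=
    continuous_abs.rpow_const fun _ => Or.inr (by linarith)
  have hc2 : Continuous (fun x : ℝ => |x| ^ (p - 1)) :=
    continuous_abs.rpow_const fun _ => Or.inr (by linarith)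
  have hsum (s y) (hs : |s| < 1) : |w y + s * φ y| ≤ M + K := by
    refine (abs_add_le _ _).trans (add_le_add (hM y) ?_)
    rw [abs_mul]
    exact (mul_le_of_le_one_left (abs_nonneg _) hs.le).trans (hK y)
  have h := hasDerivAt_integral_mul_G ht₀
    (H := fun s y => |w y + s * φ y| ^ (p + 1))
    (H' := fun s y => (p + 1) * (|w y + s * φ y| ^ (p - 1) * (w y + s * φ y)) * φ y)
    -- The sum of a bound for H and a bound for H', since a single majorant must serve both.
    (B := fun _ => (M + K) ^ (p + 1) + (p + 1) * ((M + K) ^ (p - 1) * (M + K)) * K)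
    (GaussInt.const x₀ _)
    (fun s => hc1.comp (by fun_prop))
    (by
      have := hc2.comp (f := fun y => w y + 0 * φ y) (by fun_prop)
      exact ((continuous_const.mul (this.mul (by fun_prop))).mul hφ))
    (fun s y => by
      have h1 : HasDerivAt (fun s => w y + s * φ y) (φ y) s := by
        simpa using ((hasDerivAt_id s).mul_const (φ y)).const_add (w y)
      exact (hasDerivAt_abs_rpow_add_one hp _).comp s h1)
    (fun s y hs => by
      rw [abs_of_nonneg (by positivity)]
      have h1 : |w y + s * φ y| ^ (p + 1) ≤ (M + K) ^ (p + 1) :=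
        Real.rpow_le_rpow (abs_nonneg _) (hsum s y hs) (by linarith)
      have h2 : 0 ≤ (p + 1) * ((M + K) ^ (p - 1) * (M + K)) * K := by positivity
      linarith)
    (fun s y hs => by
      have h1 : |w y + s * φ y| ^ (p - 1) ≤ (M + K) ^ (p - 1) :=
        Real.rpow_le_rpow (abs_nonneg _) (hsum s y hs) (by linarith)
      have h2 : 0 ≤ (M + K) ^ (p + 1) := by positivity
      rw [abs_mul, abs_mul, abs_mul, abs_of_nonneg (a := p + 1) (by linarith),
        abs_of_nonneg (a := |w y + s * φ y| ^ (p - 1)) (by positivity)]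
      have h3 : (p + 1) * (|w y + s * φ y| ^ (p - 1) * |w y + s * φ y|) * |φ y|
          ≤ (p + 1) * ((M + K) ^ (p - 1) * (M + K)) * K := by
        gcongr
        · exact hsum s y hs
        · exact hK y
      linarith)
    hx0 ht0 hx ht
  simpa using h

theorem hasDerivAt_square_integral (ht₀ : t₀ < 0) (hw : Continuous w)
    (hbdd : ∃ M : ℝ, ∀ y, |w y| ≤ M) (hφ : Continuous φ) (hφc : HasCompactSupport φ)
    (hx0 : x 0 = x₀) (ht0 : t 0 = t₀) (hx : HasDerivAt x v 0) (ht : HasDerivAt t τ 0) :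
    (∀ᶠ s in 𝓝 (0 : ℝ), Integrable (fun y => (w y + s * φ y) ^ 2 * G (y - x s) (t s))) ∧
    Integrable (fun y => (2 * w y * φ y
      + w y ^ 2 * logDerivG y x₀ t₀ (v, τ)) * G (y - x₀) t₀) ∧
    HasDerivAt (fun s => ∫ y, (w y + s * φ y) ^ 2 * G (y - x s) (t s))
      (∫ y, (2 * w y * φ y
        + w y ^ 2 * logDerivG y x₀ t₀ (v, τ)) * G (y - x₀) t₀) 0 := by
  obtain ⟨M, hM⟩ := hbdd
  obtain ⟨K, hK⟩ := hφc.exists_bound_of_continuous hφ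
  have hM0 : 0 ≤ M := (abs_nonneg _).trans (hM 0)
  have hK0 : 0 ≤ K := (norm_nonneg _).trans (hK 0)
  have hsum (s y) (hs : |s| < 1) : |w y + s * φ y| ≤ M + K := by
    refine (abs_add_le _ _).trans (add_le_add (hM y) ?_)
    rw [abs_mul]
    exact (mul_le_of_le_one_left (abs_nonneg _) hs.le).trans (hK y)
  have h := hasDerivAt_integral_mul_G ht₀
    (H := fun s y => (w y + s * φ y) ^ 2)
    (H' := fun s y => 2 * (w y + s * φ y) * φ y)
    (B := fun _ => (M + K) ^ 2 + 2 * (M + K) * K)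
    (GaussInt.const x₀ _) (fun s => by fun_prop) (by fun_prop)
    (fun s y => by
      have h1 : HasDerivAt (fun s => w y + s * φ y) (φ y) s := by
        simpa using ((hasDerivAt_id s).mul_const (φ y)).const_add (w y)
      simpa using h1.fun_pow 2)
    (fun s y hs => by
      rw [abs_pow]
      have h1 : |w y + s * φ y| ^ 2 ≤ (M + K) ^ 2 := by
        gcongr
        exact hsum s y hs
      have h2 : 0 ≤ 2 * (M + K) * K := by positivity
      linarith)
    (fun s y hs => by
      rw [abs_mul, abs_mul, abs_two]
      have h2 : 0 ≤ (M + K) ^ 2 := by positivity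
      have h3 : 2 * |w y + s * φ y| * |φ y| ≤ 2 * (M + K) * K := by
        gcongr
        · exact hsum s y hs
        · exact hK y
      linarith)
    hx0 ht0 hx ht
  simpa using h

/-- The derivative of `F` along a curve, in terms of the derivatives of its three integrals. -/
theorem hasDerivAt_F {w : ℝ → 𝔼 → ℝ} {j₁ j₂ j₃ : ℝ} (ht₀ : t 0 < 0)
    (ht : HasDerivAt t τ 0)
    (h₁ : HasDerivAt (fun s => ∫ y, ‖∇ (w s) y‖ ^ 2 * G (y - x s) (t s)) j₁ 0)
    (h₂ : HasDerivAt (fun s => ∫ y, |w s y| ^ (p + 1) * G (y - x s) (t s)) j₂ 0)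
    (h₃ : HasDerivAt (fun s => ∫ y, w s y ^ 2 * G (y - x s) (t s)) j₃ 0) :
    HasDerivAt (fun s => F p (x s) (t s) (w s))
      (1 / 2 * (-τ * ((p + 1) / (p - 1)) * (-t 0) ^ ((p + 1) / (p - 1) - 1))
          * (∫ y, ‖∇ (w 0) y‖ ^ 2 * G (y - x 0) (t 0))
        + 1 / 2 * (-t 0) ^ ((p + 1) / (p - 1)) * j₁
        - (1 / (p + 1) * (-τ * ((p + 1) / (p - 1)) * (-t 0) ^ ((p + 1) / (p - 1) - 1))
          * (∫ y, |w 0 y| ^ (p + 1) * G (y - x 0) (t 0))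
          + 1 / (p + 1) * (-t 0) ^ ((p + 1) / (p - 1)) * j₂)
        + (1 / (2 * (p - 1)) * (-τ * (2 / (p - 1)) * (-t 0) ^ (2 / (p - 1) - 1))
          * (∫ y, w 0 y ^ 2 * G (y - x 0) (t 0))
          + 1 / (2 * (p - 1)) * (-t 0) ^ (2 / (p - 1)) * j₃)) 0 := by
  have hA (r : ℝ) := ht.fun_neg.rpow_const (p := r) (Or.inl (neg_pos.2 ht₀).ne')
  exact ((((hA _).const_mul (1 / 2)).fun_mul h₁).fun_sub
    (((hA _).const_mul (1 / (p + 1))).fun_mul h₂)).fun_add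
    (((hA _).const_mul (1 / (2 * (p - 1)))).fun_mul h₃)

end Curves

end FirstVariation

/-! ### Critical points and the profile equation -/

section CriticalPoints

variable {n : ℕ}

/-- Merges the six integrals in the derivative of F, so that the first variation can be compared
pointwise under one integral. -/
theorem integral_linear_combination {α : Type*} [MeasurableSpace α] {μ : Measure α}
    {f₁ f₂ f₃ f₄ f₅ f₆ : α → ℝ} (h₁ : Integrable f₁ μ) (h₂ : Integrable f₂ μ)
    (h₃ : Integrable f₃ μ) (h₄ : Integrable f₄ μ) (h₅ : Integrable f₅ μ) (h₆ : Integrable f₆ μ)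
    (c₁ c₂ c₃ c₄ c₅ c₆ : ℝ) :
    c₁ * (∫ a, f₁ a ∂μ) + c₂ * (∫ a, f₂ a ∂μ) - (c₃ * (∫ a, f₃ a ∂μ) + c₄ * (∫ a, f₄ a ∂μ))
      + (c₅ * (∫ a, f₅ a ∂μ) + c₆ * (∫ a, f₆ a ∂μ))
    = ∫ a, (c₁ * f₁ a + c₂ * f₂ a - (c₃ * f₃ a + c₄ * f₄ a) + (c₅ * f₅ a + c₆ * f₆ a)) ∂μ := by
  have k₁₂ := (h₁.const_mul c₁).add (h₂.const_mul c₂)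
  have k₃₄ := (h₃.const_mul c₃).add (h₄.const_mul c₄)
  have k₅₆ := (h₅.const_mul c₅).add (h₆.const_mul c₆)
  have e := (integral_add (k₁₂.sub k₃₄) k₅₆).trans (congrArg₂ (· + ·)
    ((integral_sub k₁₂ k₃₄).trans (congrArg₂ (· - ·)
      (integral_add (h₁.const_mul c₁) (h₂.const_mul c₂))
      (integral_add (h₃.const_mul c₃) (h₄.const_mul c₄))))
    (integral_add (h₅.const_mul c₅) (h₆.const_mul c₆)))
  simp only [integral_const_mul] at e
  exact e.symm

/-- First variation of `F`, given the derivative of its gradient term. -/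
theorem hasDerivAt_F_of_gradient {p t₀ τ : ℝ} {x₀ v : EuclideanSpace ℝ (Fin n)}
    {w φ : EuclideanSpace ℝ (Fin n) → ℝ} {x : ℝ → EuclideanSpace ℝ (Fin n)} {t : ℝ → ℝ}
    (ht₀ : t₀ < 0) (hp : 1 < p) (hw : Continuous w)
    (hbdd : ∃ M : ℝ, ∀ y, |w y| ≤ M) (hφ : Continuous φ) (hφc : HasCompactSupport φ)
    (hx0 : x 0 = x₀) (ht0 : t 0 = t₀) (hx : HasDerivAt x v 0) (ht : HasDerivAt t τ 0)
    (hi : Integrable (fun y => ‖∇ w y‖ ^ 2 * G (y - x₀) t₀))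
    (hi' : Integrable (fun y => (2 * inner ℝ (∇ w y) (∇ φ y)
      + ‖∇ w y‖ ^ 2 * logDerivG y x₀ t₀ (v, τ)) * G (y - x₀) t₀))
    (hd : HasDerivAt (fun s => ∫ y, ‖∇ (fun y => w y + s * φ y) y‖ ^ 2 * G (y - x s) (t s))
      (∫ y, (2 * inner ℝ (∇ w y) (∇ φ y)
        + ‖∇ w y‖ ^ 2 * logDerivG y x₀ t₀ (v, τ)) * G (y - x₀) t₀) 0) :
    HasDerivAt (fun s => F p (x s) (t s) (fun y => w y + s * φ y))
      (∫ y, (-t₀) ^ ((p + 1) / (p - 1)) * (-(4 * Real.pi * t₀)) ^ (-(n : ℝ) / 2)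
        * ((fderiv ℝ φ y (∇ w y) - reaction p t₀ (w y) * φ y) * gauss x₀ (-(1 / (4 * t₀))) y
        + ((2 / (p - 1) * (τ / (2 * t₀)) + τ / (2 * t₀)) * ‖∇ w y‖ ^ 2
          - 2 / (p - 1) * (τ / (2 * t₀)) * (reaction p t₀ (w y) * w y)
          + (-2 * -(1 / (4 * t₀)) * inner ℝ (y - x₀) ((τ / (2 * t₀)) • (y - x₀) + v)
              + τ / (2 * t₀) * Module.finrank ℝ (EuclideanSpace ℝ (Fin n)))
            * (reactionPotential p t₀ (w y) - 1 / 2 * ‖∇ w y‖ ^ 2))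
          * gauss x₀ (-(1 / (4 * t₀))) y)) 0 := by
  obtain ⟨e2, i2, d2⟩ := hasDerivAt_power_integral ht₀ hp hw hbdd hφ hφc hx0 ht0 hx ht
  obtain ⟨e3, i3, d3⟩ := hasDerivAt_square_integral ht₀ hw hbdd hφ hφc hx0 ht0 hx ht
  have j2 := e2.self_of_nhds
  have j3 := e3.self_of_nhds
  have D := hasDerivAt_F (p := p) (w := fun s y => w y + s * φ y) (ht0.symm ▸ ht₀) ht hd d2 d3
  simp only [zero_mul, add_zero, hx0, ht0] at j2 j3 D
  refine D.congr_deriv ?_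
  refine (integral_linear_combination hi hi' j2 i2 j3 i3 _ _ _ _ _ _).trans ?_
  refine integral_congr_ae (ae_of_all _ fun y => ?_)
  have hp1 : p - 1 ≠ 0 := by linarith
  have hp2 : p + 1 ≠ 0 := by linarith
  have ht₀' : t₀ ≠ 0 := ht₀.ne
  have hneg : -t₀ ≠ 0 := neg_ne_zero.2 ht₀'
  -- The two powers of -t₀ in F differ by one factor -t₀, so a common power factors out.
  have hexp : 2 / (p - 1) = (p + 1) / (p - 1) - 1 := by
    field_simp
    ring
  have hpow2 : (-t₀) ^ (2 / (p - 1)) = (-t₀) ^ ((p + 1) / (p - 1)) / (-t₀) := by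
    rw [hexp, Real.rpow_sub_one hneg]
  have hgrad : fderiv ℝ φ y (∇ w y) = inner ℝ (∇ w y) (∇ φ y) := by
    rw [← inner_gradient_left, real_inner_comm]
  simp only [hgrad, Real.rpow_sub_one hneg, hpow2, G_eq_gauss, logDerivG_apply, reaction,
    reactionPotential, inner_add_right, inner_smul_right, real_inner_self_eq_norm_sq,
    finrank_euclideanSpace_fin, abs_rpow_add_one hp]
  -- The integrands agree pointwise, with no integration by parts: what is left is a rational
  -- identity in these quantities.
  generalize inner ℝ (∇ w y) (∇ φ y) = a₁
  generalize ‖∇ w y‖ = a₂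
  generalize inner ℝ (y - x₀) v = a₃
  generalize ‖y - x₀‖ = a₄
  generalize |w y| ^ (p - 1) = a₅
  generalize gauss x₀ (-(1 / (4 * t₀))) y = a₆
  generalize (-(4 * Real.pi * t₀)) ^ (-(n : ℝ) / 2) = a₇
  generalize (-t₀) ^ ((p + 1) / (p - 1)) = a₈
  field_simp
  ring

/-- The first variation splits into the weak form tested against φ and a Pohozaev integral; both
vanish for a solution. -/
theorem SolvesProfileEquation.isCriticalPoint {p t₀ : ℝ} {x₀ : EuclideanSpace ℝ (Fin n)}
    {w : EuclideanSpace ℝ (Fin n) → ℝ} (h : SolvesProfileEquation p x₀ t₀ w) (hp : 1 < p)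
    (ht₀ : t₀ < 0) (hw : ContDiff ℝ ∞ w) (hbdd : ∃ M : ℝ, ∀ y, |w y| ≤ M) :
    IsCriticalPoint p x₀ t₀ w := by
  obtain ⟨M, hM⟩ := id hbdd
  have heq := (solvesProfileEquation_iff p x₀ t₀ w).1 h
  have hN := continuous_reaction hp t₀
  have hq := gaussInt_norm_gradient_sq hw hN hM heq
  have hκ : 0 < -(1 / (4 * t₀)) := by
    rw [neg_pos]
    exact one_div_neg.2 (by linarith)
  intro φ x t hφ hφc hx0 ht0 hx ht
  obtain ⟨e1, i1, d1⟩ := hasDerivAt_gradient_integral ht₀ hw hq hφ hφc hx0 ht0 hx.hasDerivAt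
    ht.hasDerivAt
  obtain ⟨e2, -⟩ := hasDerivAt_power_integral ht₀ hp hw.continuous hbdd hφ.continuous hφc hx0 ht0
    hx.hasDerivAt ht.hasDerivAt
  obtain ⟨e3, -⟩ := hasDerivAt_square_integral ht₀ hw.continuous hbdd hφ.continuous hφc hx0 ht0
    hx.hasDerivAt ht.hasDerivAt
  refine ⟨by filter_upwards [e1, e2, e3] with s h1 h2 h3 using ⟨h1, h2, h3⟩, ?_⟩
  have j1 := e1.self_of_nhds
  simp only [zero_mul, add_zero, hx0, ht0] at j1
  refine (hasDerivAt_F_of_gradient ht₀ hp hw.continuous hbdd hφ.continuous hφc hx0 ht0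
    hx.hasDerivAt ht.hasDerivAt j1 i1 d1).congr_deriv ?_
  have hφ1 : ContDiff ℝ 1 φ := hφ.of_le (by simp)
  -- b = τ/(2t₀) and v = x'(0) are the rates of dilation and translation; α = 2b/(p - 1) comes from
  -- the scaling weight of w.
  obtain ⟨hi, hz⟩ := integral_pohozaev hκ hw hN (hasDerivAt_reactionPotential hp t₀) hM heq
    (2 / (p - 1) * (deriv t 0 / (2 * t₀))) (deriv t 0 / (2 * t₀)) (deriv x 0)
  have hweak := integral_weak_form hw heq hφ1 hφc
  have hwi : Integrable (fun y => (fderiv ℝ φ y (∇ w y) - reaction p t₀ (w y) * φ y)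
      * gauss x₀ (-(1 / (4 * t₀))) y) := by
    have h1 := hφ1.continuous_fderiv one_ne_zero
    have h2 := continuous_gradient hw
    have h3 := hw.continuous
    have h4 := hφ.continuous
    have h5 := continuous_gauss x₀ (-(1 / (4 * t₀)))
    refine Continuous.integrable_of_hasCompactSupport (by fun_prop) (hφc.of_fderiv ?_)
    intro y h1 h2
    simp [h1, h2]
  rw [integral_const_mul, integral_add hwi hi, hweak, hz, add_zero, mul_zero]

/-- Constant curves suffice. With no equation available yet there is no Caccioppoli estimate, so the
gradient integral is differentiated by hand. -/
theorem IsCriticalPoint.solvesProfileEquation {p t₀ : ℝ} {x₀ : EuclideanSpace ℝ (Fin n)}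
    {w : EuclideanSpace ℝ (Fin n) → ℝ} (h : IsCriticalPoint p x₀ t₀ w) (hp : 1 < p)
    (ht₀ : t₀ < 0) (hw : ContDiff ℝ ∞ w) (hbdd : ∃ M : ℝ, ∀ y, |w y| ≤ M) :
    SolvesProfileEquation p x₀ t₀ w := by
  have hN := continuous_reaction hp t₀
  have hgw := continuous_gradient hw
  have hwc := hw.continuous
  have hLc := continuous_laplacian hw
  have hgc := continuous_gauss x₀ (-(1 / (4 * t₀)))
  -- The finiteness clause of criticality, used with φ = 0.
  have j1 : Integrable (fun y => ‖∇ w y‖ ^ 2 * G (y - x₀) t₀) := by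
    have h0 := (h 0 (fun _ => x₀) (fun _ => t₀) contDiff_const HasCompactSupport.zero rfl rfl
      (differentiableAt_const _) (differentiableAt_const _)).1.self_of_nhds.gradient_term
    simpa using h0
  rw [solvesProfileEquation_iff]
  set κ := -(1 / (4 * t₀)) with hκ
  set Q : EuclideanSpace ℝ (Fin n) → ℝ := fun y =>
    Δ w y - 2 * κ * inner ℝ (y - x₀) (∇ w y) + reaction p t₀ (w y) with hQ
  have hQc : Continuous Q := by fun_prop
  -- A continuous function vanishing almost everywhere vanishes identically, and the Gaussian factor
  -- is never zero.
  suffices hae : (fun y => Q y * gauss x₀ κ y) =ᵐ[volume] fun _ => 0 by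
    have h0 := (hQc.mul hgc).ae_eq_iff_eq volume continuous_const |>.1 hae
    intro y
    exact (mul_eq_zero.1 (congrFun h0 y)).resolve_right (gauss_pos x₀ κ y).ne'
  refine ae_eq_zero_of_integral_contDiff_smul_eq_zero (hQc.mul hgc).locallyIntegrable
    fun φ hφ hφc => ?_
  have hφ1 : ContDiff ℝ 1 φ := hφ.of_le (by simp)
  have hφ0 := hφ.continuous
  have hgφ := continuous_gradient hφ
  have hφd := hφ1.continuous_fderiv one_ne_zero
  have hGc := continuous_G x₀ t₀
  have hgφc := hasCompactSupport_gradient hφc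
  have i1 : Integrable (fun y => 2 * inner ℝ (∇ w y) (∇ φ y) * G (y - x₀) t₀) := by
    refine Continuous.integrable_of_hasCompactSupport (by fun_prop) (hgφc.mono' ?_)
    intro y hy
    refine subset_tsupport _ fun h0 => hy ?_
    simp [h0]
  have i2 : Integrable (fun y => ‖∇ φ y‖ ^ 2 * G (y - x₀) t₀) := by
    refine Continuous.integrable_of_hasCompactSupport (by fun_prop) (hgφc.mono' ?_)
    intro y hy
    refine subset_tsupport _ fun h0 => hy ?_
    simp [h0]
  -- With the Gaussian frozen, the gradient integral is a quadratic polynomial in s.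
  have d1 : HasDerivAt (fun s : ℝ => ∫ y, ‖∇ (fun y => w y + s * φ y) y‖ ^ 2 * G (y - x₀) t₀)
      (∫ y, 2 * inner ℝ (∇ w y) (∇ φ y) * G (y - x₀) t₀) 0 := by
    have hexp (s : ℝ) : ∫ y, ‖∇ (fun y => w y + s * φ y) y‖ ^ 2 * G (y - x₀) t₀
        = (∫ y, ‖∇ w y‖ ^ 2 * G (y - x₀) t₀)
          + s * (∫ y, 2 * inner ℝ (∇ w y) (∇ φ y) * G (y - x₀) t₀)
          + s ^ 2 * (∫ y, ‖∇ φ y‖ ^ 2 * G (y - x₀) t₀) := by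
      have hsum := (integral_add (j1.add (i1.const_mul s)) (i2.const_mul (s ^ 2))).trans
        (congrArg (· + _) (integral_add j1 (i1.const_mul s)))
      simp only [integral_const_mul] at hsum
      rw [← hsum]
      refine integral_congr_ae (ae_of_all _ fun y => ?_)
      simp only [norm_gradient_add_mul_sq hw hφ, Pi.add_apply]
      ring
    simp_rw [hexp]
    have := (((hasDerivAt_id (0 : ℝ)).mul_const
      (∫ y, 2 * inner ℝ (∇ w y) (∇ φ y) * G (y - x₀) t₀)).const_add
      (∫ y, ‖∇ w y‖ ^ 2 * G (y - x₀) t₀)).fun_add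
      ((hasDerivAt_pow 2 (0 : ℝ)).mul_const (∫ y, ‖∇ φ y‖ ^ 2 * G (y - x₀) t₀))
    simpa using this
  have hv : ((0 : EuclideanSpace ℝ (Fin n)), (0 : ℝ)) = 0 := rfl
  have D := hasDerivAt_F_of_gradient (x := fun _ => x₀) (t := fun _ => t₀) ht₀ hp hwc hbdd hφ0 hφc
    rfl rfl (hasDerivAt_const _ _) (hasDerivAt_const _ _) j1 (by simpa [hv] using i1)
    (by simpa [hv] using d1)
  have hz := ((h φ (fun _ => x₀) (fun _ => t₀) hφ hφc rfl rfl (differentiableAt_const _)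
    (differentiableAt_const _)).2.unique D).symm
  simp only [zero_div, mul_zero, zero_mul, zero_smul, add_zero, inner_zero_right, sub_self,
    integral_const_mul] at hz
  have hpos : 0 < (-t₀) ^ ((p + 1) / (p - 1)) * (-(4 * Real.pi * t₀)) ^ (-(n : ℝ) / 2) :=
    mul_pos (Real.rpow_pos_of_pos (by linarith) _)
      (Real.rpow_pos_of_pos (by nlinarith [Real.pi_pos]) _)
  have hz' := (mul_eq_zero.1 hz).resolve_left hpos.ne'
  -- Subtracting the vanishing first variation from this identity leaves the integral of φ times Q
  -- times the Gaussian.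
  have hparts := integral_fderiv_gradient_mul_gauss hw hφ1 hφc x₀ κ
  have k1 : Integrable (fun y => (fderiv ℝ φ y (∇ w y)
      + (Δ w y - 2 * κ * inner ℝ (y - x₀) (∇ w y)) * φ y) * gauss x₀ κ y) := by
    refine Continuous.integrable_of_hasCompactSupport (by fun_prop) (hφc.of_fderiv ?_)
    intro y h1 h2
    simp [h1, h2]
  have k2 : Integrable (fun y => (fderiv ℝ φ y (∇ w y) - reaction p t₀ (w y) * φ y)
      * gauss x₀ κ y) := by
    refine Continuous.integrable_of_hasCompactSupport (by fun_prop) (hφc.of_fderiv ?_)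
    intro y h1 h2
    simp [h1, h2]
  have hdiff := integral_sub k1 k2
  rw [hparts, hz', sub_zero] at hdiff
  rw [← hdiff]
  refine integral_congr_ae (ae_of_all _ fun y => ?_)
  simp only [hQ, smul_eq_mul]
  ring

end CriticalPoints

/-! ### Self-similar solutions and their profiles -/

section SelfSimilar

variable {n : ℕ}

local notation "𝔼" => EuclideanSpace ℝ (Fin n)

/-- The backward self-similar extension of a profile given at time `t₀`. -/
def selfSimilarExtension (p : ℝ) (x₀ : 𝔼) (t₀ : ℝ) (w : 𝔼 → ℝ) (x : 𝔼) (t : ℝ) : ℝ :=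
  (t / t₀) ^ (-(1 / (p - 1))) * w (x₀ + (t / t₀) ^ (-(1 / 2) : ℝ) • (x - x₀))

theorem selfSimilarExtension_self (p : ℝ) (x₀ : 𝔼) {t₀ : ℝ} (ht₀ : t₀ < 0) (w : 𝔼 → ℝ) (x : 𝔼) :
    selfSimilarExtension p x₀ t₀ w x t₀ = w x := by
  simp [selfSimilarExtension, div_self ht₀.ne]

theorem contDiffOn_selfSimilarExtension (p : ℝ) (x₀ : 𝔼) {t₀ : ℝ} (ht₀ : t₀ < 0) {w : 𝔼 → ℝ}
    (hw : ContDiff ℝ ∞ w) :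
    ContDiffOn ℝ ∞ (fun z : 𝔼 × ℝ => selfSimilarExtension p x₀ t₀ w z.1 z.2) {z | z.2 < 0} := by
  have hne : ∀ z ∈ {z : 𝔼 × ℝ | z.2 < 0}, z.2 / t₀ ≠ 0 := fun z hz => div_ne_zero hz.ne ht₀.ne
  have hb : ContDiffOn ℝ ∞ (fun z : 𝔼 × ℝ => z.2 / t₀) {z | z.2 < 0} := by fun_prop
  have hr (r : ℝ) : ContDiffOn ℝ ∞ (fun z : 𝔼 × ℝ => (z.2 / t₀) ^ r) {z | z.2 < 0} :=
    hb.rpow_const_of_ne hne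
  have hd : ContDiffOn ℝ ∞ (fun z : 𝔼 × ℝ => z.1 - x₀) {z | z.2 < 0} := by fun_prop
  exact (hr _).mul (hw.comp_contDiffOn (contDiffOn_const.add ((hr _).smul hd)))

theorem selfSimilarExtension_scaling (p : ℝ) (x₀ : 𝔼) {t₀ : ℝ} (ht₀ : t₀ < 0) (w : 𝔼 → ℝ)
    {r t : ℝ} (x : 𝔼) (hr : 0 < r) (ht : t < 0) :
    selfSimilarExtension p x₀ t₀ w (x₀ + r • x) (r ^ 2 * t)
      = r ^ (-(2 / (p - 1))) * selfSimilarExtension p x₀ t₀ w (x₀ + x) t := by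
  have hρ : 0 < t / t₀ := div_pos_of_neg_of_neg ht ht₀
  have hpow (s : ℝ) : (r ^ 2 * t / t₀) ^ s = r ^ (2 * s) * (t / t₀) ^ s := by
    rw [mul_div_assoc, Real.mul_rpow (by positivity) hρ.le, ← Real.rpow_two, ← Real.rpow_mul hr.le]
  have h1 : r ^ (2 * -(1 / 2) : ℝ) * (t / t₀) ^ (-(1 / 2) : ℝ) * r = (t / t₀) ^ (-(1 / 2) : ℝ) := by
    rw [show (2 * -(1 / 2) : ℝ) = -1 by norm_num, Real.rpow_neg_one]
    field_simp
  have h2 : 2 * -(1 / (p - 1)) = -(2 / (p - 1)) := by ring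
  simp only [selfSimilarExtension, add_sub_cancel_left, hpow, smul_smul, h1, h2, mul_assoc]

theorem laplacian_mul_comp_dilation {w : 𝔼 → ℝ} (hw : ContDiff ℝ ∞ w) (a θ : ℝ) (x₀ x : 𝔼) :
    Δ (fun x => a * w (x₀ + θ • (x - x₀))) x = a * θ ^ 2 * Δ w (x₀ + θ • (x - x₀)) := by
  have hA (x : 𝔼) : HasFDerivAt (fun x => x₀ + θ • (x - x₀)) (θ • ContinuousLinearMap.id ℝ 𝔼) x :=
    (((hasFDerivAt_id x).sub_const x₀).const_smul θ).const_add x₀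
  have h1 : fderiv ℝ (fun x => a * w (x₀ + θ • (x - x₀)))
      = fun x => (a * θ) • fderiv ℝ w (x₀ + θ • (x - x₀)) := by
    ext x v
    have : HasFDerivAt (fun x => a * w (x₀ + θ • (x - x₀))) _ x :=
      (((hw.differentiable (by simp) _).hasFDerivAt).comp x (hA x)).const_mul a
    rw [HasFDerivAt.fderiv this]
    simp [mul_assoc]
  have h2 (v : 𝔼) : fderiv ℝ (fderiv ℝ (fun x => a * w (x₀ + θ • (x - x₀)))) x v v
      = a * θ ^ 2 * fderiv ℝ (fderiv ℝ w) (x₀ + θ • (x - x₀)) v v := by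
    have : HasFDerivAt (fun x => (a * θ) • fderiv ℝ w (x₀ + θ • (x - x₀))) _ x :=
      ((((contDiff_fderiv hw).differentiable (by simp) _).hasFDerivAt).comp x
        (hA x)).const_smul (a * θ)
    rw [h1, HasFDerivAt.fderiv this]
    simp
    ring
  rw [laplacian_eq_sum_fderiv (stdOrthonormalBasis ℝ 𝔼),
    laplacian_eq_sum_fderiv (stdOrthonormalBasis ℝ 𝔼), Finset.mul_sum]
  simp_rw [h2]

/-- The defect in the heat equation of the self-similar extension of `w` is a multiple of the
defect in the profile equation of `w`. -/
theorem selfSimilarExtension_equation {p : ℝ} (hp : 1 < p) (x₀ : 𝔼) {t₀ : ℝ} (ht₀ : t₀ < 0)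
    {w : 𝔼 → ℝ} (hw : ContDiff ℝ ∞ w) (x : 𝔼) {t : ℝ} (ht : t < 0) {y : 𝔼}
    (hy : y = x₀ + (t / t₀) ^ (-(1 / 2) : ℝ) • (x - x₀)) :
    Δ (fun z => selfSimilarExtension p x₀ t₀ w z t) x
      + |selfSimilarExtension p x₀ t₀ w x t| ^ (p - 1) * selfSimilarExtension p x₀ t₀ w x t
      - deriv (fun τ => selfSimilarExtension p x₀ t₀ w x τ) t
    = (t / t₀) ^ (-(1 / (p - 1))) * (t / t₀)⁻¹
      * (Δ w y + inner ℝ ((1 / (2 * t₀)) • (y - x₀)) (∇ w y)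
      + 1 / ((p - 1) * t₀) * w y + |w y| ^ (p - 1) * w y) := by
  have hρ : 0 < t / t₀ := div_pos_of_neg_of_neg ht ht₀
  have hp1 : p - 1 ≠ 0 := by linarith
  have ht₀' : t₀ ≠ 0 := ht₀.ne
  have hpd (r : ℝ) : HasDerivAt (fun τ : ℝ => (τ / t₀) ^ r) (1 / t₀ * r * (t / t₀) ^ (r - 1)) t :=
    ((hasDerivAt_id t).div_const t₀).rpow_const (Or.inl hρ.ne')
  have hθ2 : ((t / t₀) ^ (-(1 / 2) : ℝ)) ^ 2 = (t / t₀)⁻¹ := by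
    rw [← Real.rpow_two, ← Real.rpow_mul hρ.le, ← Real.rpow_neg_one]
    norm_num
  -- The exponent -1/(p - 1) is chosen so that the nonlinearity scales by the same (t/t₀)⁻¹ as the
  -- Laplacian.
  have hB : |(t / t₀) ^ (-(1 / (p - 1)))| ^ (p - 1) = (t / t₀)⁻¹ := by
    rw [abs_of_pos (Real.rpow_pos_of_pos hρ _), ← Real.rpow_mul hρ.le, ← Real.rpow_neg_one]
    congr 1
    field_simp
  have hY : HasDerivAt (fun τ : ℝ => x₀ + (τ / t₀) ^ (-(1 / 2) : ℝ) • (x - x₀))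
      ((1 / t₀ * (-(1 / 2)) * (t / t₀) ^ (-(1 / 2) - 1 : ℝ)) • (x - x₀)) t :=
    ((hpd _).smul_const _).const_add x₀
  have hwd : HasFDerivAt w (fderiv ℝ w y) (x₀ + (t / t₀) ^ (-(1 / 2) : ℝ) • (x - x₀)) := by
    rw [← hy]
    exact (hw.differentiable (by simp) y).hasFDerivAt
  have hder := ((hpd (-(1 / (p - 1)))).fun_mul (hwd.comp_hasDerivAt t hY)).deriv
  have hz : y - x₀ = (t / t₀) ^ (-(1 / 2) : ℝ) • (x - x₀) := by
    rw [hy, add_sub_cancel_left]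
  have hgr : inner ℝ ((1 / (2 * t₀)) • (y - x₀)) (∇ w y)
      = 1 / (2 * t₀) * ((t / t₀) ^ (-(1 / 2) : ℝ) * fderiv ℝ w y (x - x₀)) := by
    rw [hz, real_inner_comm, inner_gradient_left, map_smul, map_smul, smul_eq_mul, smul_eq_mul]
  simp only [Function.comp_def] at hder
  simp only [selfSimilarExtension]
  rw [laplacian_mul_comp_dilation hw, hder, hgr, hθ2, abs_mul,
    Real.mul_rpow (abs_nonneg _) (abs_nonneg _), hB, ← hy, map_smul, smul_eq_mul,
    Real.rpow_sub_one hρ.ne', Real.rpow_sub_one hρ.ne']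
  generalize (t / t₀) ^ (-(1 / (p - 1))) = b
  generalize (t / t₀) ^ (-(1 / 2) : ℝ) = θ
  generalize t / t₀ = ρ at *
  have hρ' := hρ.ne'
  field_simp
  ring

/-- Scaling by r = (t/t₀)^{1/2} carries the slice t₀ to the slice t, so the profile determines u at
all negative times. -/
theorem IsSelfSimilarSolution.eq_extension {p : ℝ} {x₀ : 𝔼} {t₀ : ℝ} (ht₀ : t₀ < 0)
    {w : 𝔼 → ℝ} {u : 𝔼 → ℝ → ℝ} (hu : IsSelfSimilarSolution p x₀ u) (huw : ∀ y, u y t₀ = w y)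
    (x : 𝔼) {t : ℝ} (ht : t < 0) : u x t = selfSimilarExtension p x₀ t₀ w x t := by
  have hρ : 0 < t / t₀ := div_pos_of_neg_of_neg ht ht₀
  have h := hu.self_similar ((t / t₀) ^ (1 / 2 : ℝ)) ((t / t₀) ^ (-(1 / 2) : ℝ) • (x - x₀)) t₀
    (Real.rpow_pos_of_pos hρ _) ht₀
  have h1 : ((t / t₀) ^ (1 / 2 : ℝ)) ^ 2 * t₀ = t := by
    rw [← Real.rpow_two, ← Real.rpow_mul hρ.le]
    norm_num
    exact div_mul_cancel₀ t ht₀.ne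
  have h2 : (t / t₀) ^ (1 / 2 : ℝ) * (t / t₀) ^ (-(1 / 2) : ℝ) = 1 := by
    rw [← Real.rpow_add hρ]
    norm_num
  have h3 : ((t / t₀) ^ (1 / 2 : ℝ)) ^ (-(2 / (p - 1))) = (t / t₀) ^ (-(1 / (p - 1))) := by
    rw [← Real.rpow_mul hρ.le]
    ring_nf
  rw [h1, smul_smul, h2, one_smul, add_sub_cancel, h3, huw] at h
  exact h

theorem solvesProfileEquation_iff_exists_selfSimilar {p : ℝ} (hp : 1 < p) (x₀ : 𝔼) {t₀ : ℝ}
    (ht₀ : t₀ < 0) {w : 𝔼 → ℝ} (hw : ContDiff ℝ ∞ w) :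
    SolvesProfileEquation p x₀ t₀ w ↔
      ∃ u : 𝔼 → ℝ → ℝ, IsSelfSimilarSolution p x₀ u ∧ ∀ y, u y t₀ = w y := by
  constructor
  · intro h
    refine ⟨selfSimilarExtension p x₀ t₀ w, ⟨contDiffOn_selfSimilarExtension p x₀ ht₀ hw,
      fun x t ht => ?_, fun r x t hr ht => selfSimilarExtension_scaling p x₀ ht₀ w x hr ht⟩,
      selfSimilarExtension_self p x₀ ht₀ w⟩
    have he := selfSimilarExtension_equation hp x₀ ht₀ hw x ht rfl
    rw [h, mul_zero] at he
    exact (sub_eq_zero.1 he).symm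
  · rintro ⟨u, hu, huw⟩ x
    have hx : x = x₀ + (t₀ / t₀) ^ (-(1 / 2) : ℝ) • (x - x₀) := by
      simp [div_self ht₀.ne]
    have he := selfSimilarExtension_equation hp x₀ ht₀ hw x ht₀ hx
    -- The time derivative at t₀ requires agreement at nearby times, not only on the slice.
    have hd : deriv (fun τ => selfSimilarExtension p x₀ t₀ w x τ) t₀ = deriv (fun τ => u x τ) t₀ := by
      refine Filter.EventuallyEq.deriv_eq ?_
      filter_upwards [eventually_lt_nhds ht₀] with τ hτ
      exact (hu.eq_extension ht₀ huw x hτ).symm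
    have hf : (fun z => selfSimilarExtension p x₀ t₀ w z t₀) = fun z => u z t₀ :=
      funext fun z => (hu.eq_extension ht₀ huw z ht₀).symm
    rw [hd, hf, ← hu.eq_extension ht₀ huw x ht₀, hu.equation x t₀ ht₀, sub_self, div_self ht₀.ne,
      Real.one_rpow, inv_one, one_mul, one_mul] at he
    exact he.symm

end SelfSimilar

end FujitaF

end

theorem proposition3p2 {n : ℕ} (p : ℝ) (hp : 1 < p)
    (x₀ : EuclideanSpace ℝ (Fin n)) (t₀ : ℝ) (ht₀ : t₀ < 0)
    (w : EuclideanSpace ℝ (Fin n) → ℝ) (hw : ContDiff ℝ ∞ w)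
    (hbdd : ∃ M : ℝ, ∀ y, |w y| ≤ M) :
    (FujitaF.IsCriticalPoint p x₀ t₀ w ↔ FujitaF.SolvesProfileEquation p x₀ t₀ w) ∧
    (FujitaF.SolvesProfileEquation p x₀ t₀ w ↔
      ∃ u : EuclideanSpace ℝ (Fin n) → ℝ → ℝ,
        FujitaF.IsSelfSimilarSolution p x₀ u ∧ ∀ y, u y t₀ = w y) :=
  ⟨⟨fun h => h.solvesProfileEquation hp ht₀ hw hbdd,
    fun h => h.isCriticalPoint hp ht₀ hw hbdd⟩,
    FujitaF.solvesProfileEquation_iff_exists_selfSimilar hp x₀ ht₀ hw⟩
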